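/- Let $D=f^2D_0>0$ be a non-square discriminant, with $D_0$ a fundamental discriminant and $f\ge 1$. Let $K=\mathbb Q(\sqrt D)$, with its two distinct embeddings $\iota_1,\iota_2:K\to\mathbb R$, let $\mathfrak o_D=\mathbb Z[(D+\sqrt D)/2]$ be the order of discriminant $D$ in $K$, and let $\mathfrak o_D^\vee=\{x\in K:\operatorname{Tr}_{K/\mathbb Q}(x\,\mathfrak o_D)\subset\mathbb Z\}$ be its trace dual. For lattices $\mathfrak b,\mathfrak c\subset K$ let $\mathrm{SL}(\mathfrak b\oplus\mathfrak c)$ be the group of all $g\in\mathrm{SL}_2(K)$ that map $\mathfrak b\oplus\mathfrak c\subset K^2$ onto itself; it acts on $\mathbb H^2$ by Möbius transformations through $\iota_1$ and $\iota_2$. Let $X_D=\mathbb H^2/\mathrm{SL}(\mathfrak o_D\oplus\mathfrak o_D^\vee)$, and let $X_{D,(1,2)}=\mathbb H^2/\mathrm{SL}(\mathfrak a\oplus\mathfrak o_D^\vee)$, where $\mathfrak a\subset\mathfrak o_D$ is any ideal with $|\mathfrak o_D/\mathfrak a|=2$ (such an ideal exists if and only if $D\not\equiv 5 \bmod 8$).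 For a quotient of $\mathbb H^2$ by one of these groups let $\chi$ be the orbifold Euler characteristic, that is, the integral of the Gauss–Bonnet form $\frac1{4\pi^2}\frac{dx_1\,dy_1}{y_1^2}\frac{dx_2\,dy_2}{y_2^2}$ over a fundamental domain of the group of transformations. Then $$\frac{\chi(X_{D,(1,2)})}{\chi(X_D)}=\begin{cases}1 & \text{if } 2\nmid f,\\ 3/2 & \text{if } 2\mid f.\end{cases}$$ -/

import Mathlib

open scoped UpperHalfPlane MatrixGroups

namespace HilbertModular

/-- `d` is a fundamental discriminant: `d ≡ 1 mod 4` is squarefree, or `d = 4 m` with `m` squarefree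
and `m ≡ 2, 3 mod 4`. (As usual `d = 1` is included; it belongs to square discriminants `f ^ 2`.) -/
def IsFundamentalDiscriminant (d : ℤ) : Prop :=
  (d % 4 = 1 ∧ Squarefree d) ∨ ∃ m : ℤ, d = 4 * m ∧ (m % 4 = 2 ∨ m % 4 = 3) ∧ Squarefree m

section Orders

variable {K : Type*} [Field K]

/-- The quadratic order `𝔬_D = ℤ[(D + √D) / 2]` of discriminant `D ≡ 0, 1 mod 4`,
where `sqrtD` is a square root of `D` in the field `K`. -/
noncomputable def quadraticOrder (D : ℤ) (sqrtD : K) : Subalgebra ℤ K :=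
  Algebra.adjoin ℤ {((D : K) + sqrtD) / 2}

/-- An ideal of a subring `R` of `K`, seen as a lattice (an additive subgroup) in `K`. -/
def idealLattice (R : Subalgebra ℤ K) (I : Ideal R) : Submodule ℤ K :=
  (I.restrictScalars ℤ).map R.val.toLinearMap

/-- The dual `R^∨ = {x ∈ K : Tr (x y) ∈ ℤ for all y ∈ R}` with respect to the trace of `K / ℚ`. -/
noncomputable def traceDual [Algebra ℚ K] (R : Subalgebra ℤ K) : Submodule ℤ K :=
  (Algebra.traceForm ℚ K).dualSubmodule (Subalgebra.toSubmodule R)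

/-- The group `SL (I ⊕ J)` of all `g ∈ SL₂(K)` that map the lattice `I ⊕ J` of column vectors in
`K ²` onto itself (`g` is bijective on `K ²`, so this is `v ∈ I ⊕ J ↔ g v ∈ I ⊕ J`). -/
def slLattice (I J : Submodule ℤ K) : Subgroup SL(2, K) where
  carrier := {g | ∀ v : Fin 2 → K,
    ((g.1.mulVec v) 0 ∈ I ∧ (g.1.mulVec v) 1 ∈ J) ↔ (v 0 ∈ I ∧ v 1 ∈ J)}
  one_mem' := by
    intro v
    simp
  mul_mem' := by
    intro g h hg hh v
    have e : (g * h).1.mulVec v = g.1.mulVec (h.1.mulVec v) := by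
      rw [Matrix.mulVec_mulVec, ← Matrix.SpecialLinearGroup.coe_mul]
    rw [e]
    exact (hg _).trans (hh v)
  inv_mem' := by
    intro g hg v
    have e : g.1.mulVec ((g⁻¹).1.mulVec v) = v := by
      rw [Matrix.mulVec_mulVec, ← Matrix.SpecialLinearGroup.coe_mul, mul_inv_cancel]
      simp
    have h := hg ((g⁻¹).1.mulVec v)
    rw [e] at h
    exact h.symm

end Orders

/-- The action of `SL₂(K)` on `ℍ × ℍ` by Möbius transformations,
`g • (z₁, z₂) = (ι₁(g) z₁, ι₂(g) z₂)`, for two real embeddings of `K`. -/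
noncomputable def actionHom {K : Type*} [Field K] (ι₁ ι₂ : K →+* ℝ) :
    SL(2, K) →* Equiv.Perm (ℍ × ℍ) where
  toFun g := Equiv.prodCongr
    (MulAction.toPerm (Matrix.SpecialLinearGroup.map ι₁ g : SL(2, ℝ)))
    (MulAction.toPerm (Matrix.SpecialLinearGroup.map ι₂ g : SL(2, ℝ)))
  map_one' := by
    ext z <;> simp
  map_mul' g h := by
    ext z <;> simp [mul_smul]

/-- The Gauss–Bonnet (Euler) measure of `ℍ × ℍ`: the product `ω₁ ∧ ω₂` of the two Chern forms
`ωᵢ = (1 / 2π) dxᵢ dyᵢ / yᵢ ²` of the natural foliations. (Each factor has curvature `-1`, and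
the two signs cancel.) -/
noncomputable def gaussBonnetMeasure : MeasureTheory.Measure (ℍ × ℍ) :=
  ENNReal.ofReal ((1 / (2 * Real.pi)) ^ 2) • (MeasureTheory.volume : MeasureTheory.Measure (ℍ × ℍ))

/-- The orbifold Euler characteristic of `ℍ ² / Γ` for a lattice `Γ` of holomorphic isometries of
`ℍ × ℍ` (a group of transformations, so acting effectively), in the differential geometric sense:
the integral of the Gauss–Bonnet form over the quotient, i.e. over a fundamental domain. -/
noncomputable def orbifoldEulerChar (Γ : Subgroup (Equiv.Perm (ℍ × ℍ))) : ℝ :=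
  (MeasureTheory.covolume Γ (ℍ × ℍ) gaussBonnetMeasure).toReal

section Surfaces

variable {K : Type*} [Field K] [NumberField K]

/-- The transformation group of `ℍ ²` defining the Hilbert modular surface
`X_D = ℍ ² / SL (𝔬_D ⊕ 𝔬_D^∨)`. -/
noncomputable def groupX (ι₁ ι₂ : K →+* ℝ) (D : ℤ) (sqrtD : K) : Subgroup (Equiv.Perm (ℍ × ℍ)) :=
  (slLattice (Subalgebra.toSubmodule (quadraticOrder D sqrtD))
    (traceDual (quadraticOrder D sqrtD))).map (actionHom ι₁ ι₂)

/-- The transformation group of `ℍ ²` defining the Hilbert modular surface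
`ℍ ² / SL (𝔞 ⊕ 𝔬_D^∨)`; this is `X_{D,(1,2)}` for an ideal `𝔞 ⊆ 𝔬_D` of norm two. -/
noncomputable def groupX12 (ι₁ ι₂ : K →+* ℝ) (D : ℤ) (sqrtD : K)
    (𝔞 : Ideal (quadraticOrder D sqrtD)) : Subgroup (Equiv.Perm (ℍ × ℍ)) :=
  (slLattice (idealLattice (quadraticOrder D sqrtD) 𝔞)
    (traceDual (quadraticOrder D sqrtD))).map (actionHom ι₁ ι₂)

end Surfaces

end HilbertModular

/-! Write `O` for the order of discriminant `D` and `δ = √D`. Since `O^∨ = δ⁻¹ O`, a matrix `(a, b;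
c, d)` lies in `Γ₁ = SL(O ⊕ O^∨)` iff `a, d, b/δ, δc ∈ O`, and in `Γ₂ = SL(𝔞 ⊕ O^∨)` iff `a, d ∈ O`,
`b/δ ∈ 𝔞` and `δc ∈ (O : 𝔞)`. The Euler characteristic is a volume, so the ratio sought is `[Γ₁ : Γ₁
∩ Γ₂] / [Γ₂ : Γ₁ ∩ Γ₂]`.

Arithmetic. Reduction modulo `𝔞` maps `Γ₁` onto `SL₂(𝔽₂)`, and `Γ₁ ∩ Γ₂` is the preimage of the
lower triangular matrices, so the first index is 3 (`relIndex_stabilizer_eq_three`). If `f` is odd,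
`𝔞` is invertible, and a rescaled reduction of `Γ₂` gives 3 again
(`relIndex_stabilizer_eq_three_of_invertible`). If `f` is even, `(O : 𝔞)` is the order of
discriminant `D/4`, and it maps `𝔞` into itself. Hence `bc ∈ 𝔞`, so `a` and `d` are odd on all of
`Γ₂`, and the class of `δc` in `(O : 𝔞)/O ≅ ℤ/2` cuts out a subgroup of index 2
(`relIndex_stabilizer_eq_two_of_even_conductor`).

Analysis. `covolume` and `toReal` have junk value 0, so fundamental domains must exist and the
volume in the denominator must be positive and finite. Existence follows from proper discontinuity
and the nullity of fixed point sets (`exists_isFundamentalDomain_map`). Finiteness is reduction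
theory (`exists_covering_measure_lt_top`): Minkowski's theorem gives a short vector `(c, d)`,
finiteness of the class number completes it to a matrix of bounded determinant, and Pell units with
translations move the point into a product of half strips. Both groups contain `-1`, so indices do
not change on passing to transformations. -/

namespace HilbertModular

open MeasureTheory Set Topology Pointwise

/-! ### Fundamental domains and covolumes of commensurable groups. -/

section FundamentalDomains

/-- If almost every point has an open neighbourhood which is disjoint from all its translates,
then a countable group has a fundamental domain. -/
theorem exists_isFundamentalDomain {G X : Type*} [Group G] [Countable G] [TopologicalSpace X]
    [SecondCountableTopology X] [MeasurableSpace X] [OpensMeasurableSpace X] [MulAction G X]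
    [MeasurableConstSMul G X] {μ : Measure X} [SMulInvariantMeasure G X μ]
    (h : ∀ᵐ x ∂μ, ∃ U : Set X, IsOpen U ∧ x ∈ U ∧ ∀ g : G, g ≠ 1 → ∀ y ∈ U, g • y ∉ U) :
    ∃ s : Set X, IsFundamentalDomain G s μ := by
  classical
  -- The empty set is added only so that the family is nonempty and can be enumerated by `ℕ`.
  let B := insert ∅ {U ∈ TopologicalSpace.countableBasis X | ∀ g : G, g ≠ 1 → ∀ y ∈ U, g • y ∉ U}
  have hBc : B.Countable :=
    ((TopologicalSpace.countable_countableBasis X).mono (Set.sep_subset _ _)).insert _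
  obtain ⟨e, he⟩ := hBc.exists_eq_range ⟨∅, mem_insert _ _⟩
  have heB : ∀ n, e n ∈ B := fun n => he ▸ mem_range_self n
  have hedisj : ∀ n, ∀ g : G, g ≠ 1 → ∀ y ∈ e n, g • y ∉ e n := by
    intro n
    rcases heB n with h0 | h0
    · simp [h0]
    · exact h0.2
  have hemeas : ∀ n, MeasurableSet (e n) := by
    intro n
    rcases heB n with h0 | h0
    · simp [h0]
    · exact (TopologicalSpace.isOpen_of_mem_countableBasis h0.1).measurableSet
  -- From each orbit keep the point in the first `e n` that the orbit meets; wandering of `e n`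
  -- makes this point unique.
  let F : Set X := ⋃ n, e n \ ⋃ k, ⋃ (_ : k < n), ⋃ g : G, g • e k
  have hF : ∀ x, x ∈ F ↔ ∃ n, x ∈ e n ∧ ∀ k < n, ∀ g : G, g • x ∉ e k := by
    intro x
    simp only [F, mem_iUnion, mem_sdiff, not_exists]
    refine exists_congr fun n => and_congr_right fun _ => forall₂_congr fun k _ => ?_
    constructor
    · intro hx g hg
      exact hx g⁻¹ (mem_smul_set_iff_inv_smul_mem.2 (by simpa using hg))
    · intro hx g hg
      exact hx g⁻¹ (mem_smul_set_iff_inv_smul_mem.1 hg)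
  refine ⟨F, IsFundamentalDomain.mk'' ?_ ?_ ?_ fun g =>
    (measurePreserving_smul g μ).quasiMeasurePreserving⟩
  · refine (MeasurableSet.iUnion fun n => (hemeas n).diff <| MeasurableSet.iUnion fun k =>
      MeasurableSet.iUnion fun _ => MeasurableSet.iUnion fun g =>
        (hemeas k).const_smul g).nullMeasurableSet
  · filter_upwards [h] with x hx
    obtain ⟨U, hU, hxU, hUd⟩ := hx
    obtain ⟨V, hV, hxV, hVU⟩ := (TopologicalSpace.isBasis_countableBasis X).exists_subset_of_mem_open
      hxU hU
    have hVB : V ∈ B := Or.inr ⟨hV, fun g hg y hy hgy => hUd g hg y (hVU hy) (hVU hgy)⟩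
    obtain ⟨n₀, hn₀⟩ : ∃ n, e n = V := by rw [he] at hVB; exact hVB
    have hex : ∃ n, ∃ g : G, g • x ∈ e n := ⟨n₀, 1, by simpa [hn₀] using hxV⟩
    obtain ⟨g, hg⟩ := Nat.find_spec hex
    refine ⟨g, (hF _).2 ⟨Nat.find hex, hg, fun k hk g' hg' => Nat.find_min hex hk ⟨g' * g, ?_⟩⟩⟩
    rwa [mul_smul]
  · intro g hg
    refine Disjoint.aedisjoint (Set.disjoint_left.2 ?_)
    rintro _ ⟨x, hx, rfl⟩ hgx
    obtain ⟨n, hn, hn'⟩ := (hF _).1 hx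
    obtain ⟨m, hm, hm'⟩ := (hF _).1 hgx
    rcases lt_trichotomy n m with hlt | rfl | hlt
    · exact hm' n hlt g⁻¹ (by simpa using hn)
    · exact hedisj n g hg x hn hm
    · exact hn' m hlt g hm

/-- The volume of a fundamental domain is bounded by that of any set meeting all orbits. -/
theorem measure_fundamentalDomain_le_of_forall_exists_smul_mem {G X : Type*} [Group G]
    [Countable G] [MeasurableSpace X] [MulAction G X] [MeasurableConstSMul G X] {μ : Measure X}
    [SMulInvariantMeasure G X μ] {F S : Set X} (hF : IsFundamentalDomain G F μ)
    (hS : ∀ x, ∃ g : G, g • x ∈ S) : μ F ≤ μ S := by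
  have hsub : F ⊆ ⋃ g : G, g • S ∩ F := by
    intro x hx
    obtain ⟨g, hg⟩ := hS x
    exact mem_iUnion.2 ⟨g⁻¹, mem_smul_set_iff_inv_smul_mem.2 (by simpa using hg), hx⟩
  calc μ F ≤ μ (⋃ g : G, g • S ∩ F) := measure_mono hsub
    _ ≤ ∑' g : G, μ (g • S ∩ F) := measure_iUnion_le _
    _ = μ S := (hF.measure_eq_tsum S).symm

/-- A fundamental domain of a subgroup of index `n` has `n` times the volume of a fundamental
domain of the group. -/
theorem measure_fundamentalDomain_subgroup {P X : Type*} [Group P] [MeasurableSpace X]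
    [MulAction P X] {μ : Measure X} {H G : Subgroup P} (hHG : H ≤ G) [Countable G]
    [MeasurableConstSMul G X] [SMulInvariantMeasure G X μ]
    [MeasurableConstSMul H X] [SMulInvariantMeasure H X μ]
    (hfin : H.relIndex G ≠ 0) {s t : Set X}
    (hs : IsFundamentalDomain G s μ) (ht : IsFundamentalDomain H t μ) :
    μ t = H.relIndex G * μ s := by
  have : Countable H := (Subgroup.inclusion_injective hHG).countable
  let A := H.subgroupOf G
  have : Finite (G ⧸ A) := Nat.finite_of_card_ne_zero hfin
  have : Fintype (G ⧸ A) := Fintype.ofFinite _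
  -- The group `G` is the disjoint union of the cosets `H q⁻¹`, with `q` running over
  -- representatives of `G / H`. The translates of `s` along one coset cut `t` into pieces of total
  -- measure `μ (q⁻¹ s) = μ s`.
  have hbij : Function.Bijective fun p : (G ⧸ A) × H =>
      (Subgroup.inclusion hHG p.2)⁻¹ * (p.1.out)⁻¹ := by
    have hA : ∀ h : H, Subgroup.inclusion hHG h ∈ A := fun h => Subgroup.mem_subgroupOf.2 h.2
    constructor
    · rintro ⟨q, h⟩ ⟨q', h'⟩ e
      simp only [← mul_inv_rev, inv_inj] at e
      have hq : q = q' := by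
        rw [← QuotientGroup.out_eq' q, ← QuotientGroup.out_eq' q', ← QuotientGroup.mk_mul_of_mem q.out (hA h), e,
          QuotientGroup.mk_mul_of_mem _ (hA h')]
      subst hq
      have := Subgroup.inclusion_injective hHG (mul_left_cancel e)
      rw [this]
    · intro g
      have hg : (QuotientGroup.mk g⁻¹ : G ⧸ A).out⁻¹ * g⁻¹ ∈ A :=
        QuotientGroup.eq.1 (QuotientGroup.out_eq' _)
      refine ⟨(QuotientGroup.mk g⁻¹, ⟨_, Subgroup.mem_subgroupOf.1 hg⟩), ?_⟩
      apply Subtype.ext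
      simp
  let E : (G ⧸ A) × H ≃ G := Equiv.ofBijective _ hbij
  have hE : ∀ q h, E (q, h) = (Subgroup.inclusion hHG h)⁻¹ * (q.out)⁻¹ := fun _ _ => rfl
  calc μ t = ∑' g : G, μ (t ∩ g • s) := hs.measure_eq_tsum' t
    _ = ∑' p : (G ⧸ A) × H, μ (t ∩ E p • s) := (E.tsum_eq fun g : G => μ (t ∩ g • s)).symm
    _ = ∑' q : G ⧸ A, ∑' h : H, μ (t ∩ E (q, h) • s) := ENNReal.tsum_prod (f := fun q h => μ (t ∩ E (q, h) • s))
    _ = ∑' q : G ⧸ A, μ s := by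
      refine tsum_congr fun q => ?_
      rw [← measure_smul μ (q.out)⁻¹ s, ht.measure_eq_tsum, ← (Equiv.inv H).tsum_eq]
      refine tsum_congr fun h => ?_
      rw [hE, mul_smul, inter_comm, Equiv.inv_apply, map_inv, inv_inv]
      rfl
    _ = H.relIndex G * μ s := by
      rw [tsum_fintype, Finset.sum_const, nsmul_eq_mul, Finset.card_univ, ← Nat.card_eq_fintype_card]
      rfl

/-- Covolumes of commensurable groups. -/
theorem covolume_ratio {P X : Type*} [Group P] [MeasurableSpace X]
    [MulAction P X] {μ : Measure X} {G₁ G₂ : Subgroup P} [Countable G₁] [Countable G₂]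
    [MeasurableConstSMul G₁ X] [SMulInvariantMeasure G₁ X μ]
    [MeasurableConstSMul G₂ X] [SMulInvariantMeasure G₂ X μ]
    (h₁ : G₂.relIndex G₁ ≠ 0) (h₂ : G₁.relIndex G₂ ≠ 0) {s₁ s₂ t : Set X}
    (hs₁ : IsFundamentalDomain G₁ s₁ μ) (hs₂ : IsFundamentalDomain G₂ s₂ μ)
    (ht : IsFundamentalDomain (G₁ ⊓ G₂ : Subgroup P) t μ)
    (hpos : μ s₁ ≠ 0) (hfin : μ s₁ ≠ ⊤) :
    (covolume G₂ X μ).toReal / (covolume G₁ X μ).toReal = G₂.relIndex G₁ / G₁.relIndex G₂ := by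
  have : MeasurableConstSMul (G₁ ⊓ G₂ : Subgroup P) X :=
    ⟨fun c => measurable_const_smul (Subgroup.inclusion inf_le_left c : G₁)⟩
  have : SMulInvariantMeasure (G₁ ⊓ G₂ : Subgroup P) X μ :=
    ⟨fun c _ hs => SMulInvariantMeasure.measure_preimage_smul
      (Subgroup.inclusion inf_le_left c : G₁) hs⟩
  have e₁ := measure_fundamentalDomain_subgroup (μ := μ) inf_le_left
    (by rwa [Subgroup.inf_relIndex_left]) hs₁ ht
  have e₂ := measure_fundamentalDomain_subgroup (μ := μ) inf_le_right
    (by rwa [Subgroup.inf_relIndex_right]) hs₂ ht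
  rw [Subgroup.inf_relIndex_left] at e₁
  rw [Subgroup.inf_relIndex_right] at e₂
  rw [hs₁.covolume_eq_volume, hs₂.covolume_eq_volume]
  -- Both products equal `μ t`. As `toReal` is multiplicative, finiteness of `μ s₂` is not needed
  -- here.
  have e := congrArg ENNReal.toReal (e₁.symm.trans e₂)
  simp only [ENNReal.toReal_mul, ENNReal.toReal_natCast] at e
  have hp : 0 < (μ s₁).toReal := ENNReal.toReal_pos hpos hfin
  have h₂' : (G₁.relIndex G₂ : ℝ) ≠ 0 := by exact_mod_cast h₂
  rw [div_eq_div_iff hp.ne' h₂', e]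
  ring

end FundamentalDomains

end HilbertModular

namespace HilbertModular

open MeasureTheory Set Topology Pointwise

/-! ### Möbius transformations of one upper half plane. -/

section UpperHalfPlaneLemmas

open UpperHalfPlane

theorem volume_upperHalfPlane_singleton (z : ℍ) : volume ({z} : Set ℍ) = 0 := by
  rw [volume_eq_lintegral]
  exact setLIntegral_measure_zero _ _ (by simp)

/-- For a point of the upper half plane fixed by a real matrix of determinant one. -/
theorem eq_of_smul_eq_self {g : SL(2, ℝ)} {z : ℍ} (h : g • z = z) :
    g 0 0 - g 1 1 = 2 * g 1 0 * z.re ∧ g 0 1 = -g 1 0 * (z.re ^ 2 + z.im ^ 2) := by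
  have h1 := congrArg UpperHalfPlane.coe h
  rw [coe_specialLinearGroup_apply] at h1
  have hd : ((g 1 0 : ℝ) : ℂ) * z + (g 1 1 : ℝ) ≠ 0 := by
    refine linear_ne_zero (cd := ![g 1 0, g 1 1]) z fun h0 => ?_
    have h10 : g 1 0 = 0 := congrFun h0 0
    have h11 : g 1 1 = 0 := congrFun h0 1
    have := g.det_coe
    rw [Matrix.det_fin_two, h10, h11] at this
    simp at this
  rw [div_eq_iff (by simpa using hd)] at h1
  have hre := congrArg Complex.re h1
  have him := congrArg Complex.im h1
  simp at hre him
  have hy := z.im_pos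
  -- The fixed point equation is `c z² + (d - a) z - b = 0`, with imaginary part `y (2 c x + d -
  -- a)`.
  have h2 : g 0 0 - g 1 1 = 2 * g 1 0 * z.re := by
    apply mul_right_cancel₀ hy.ne'
    linear_combination him
  refine ⟨h2, ?_⟩
  linear_combination hre - z.re * h2

/-- A real matrix of determinant one with two fixed points in the upper half plane is scalar. -/
theorem scalar_of_smul_eq_self {g : SL(2, ℝ)} {z w : ℍ} (hzw : z ≠ w) (hz : g • z = z)
    (hw : g • w = w) : g 1 0 = 0 ∧ g 0 1 = 0 ∧ g 0 0 = g 1 1 := by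
  obtain ⟨h1, h2⟩ := eq_of_smul_eq_self hz
  obtain ⟨h3, h4⟩ := eq_of_smul_eq_self hw
  have h10 : g 1 0 = 0 := by
    by_contra hc
    apply hzw
    have hre : z.re = w.re := by
      apply mul_left_cancel₀ (mul_ne_zero two_ne_zero hc)
      rw [← h1, ← h3]
    have hsq : z.im ^ 2 = w.im ^ 2 := by
      have h5 := mul_left_cancel₀ (neg_ne_zero.2 hc) (h2.symm.trans h4)
      rw [hre] at h5
      linarith
    have him : z.im = w.im := (pow_left_inj₀ z.im_pos.le w.im_pos.le two_ne_zero).1 hsq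
    exact UpperHalfPlane.ext_re_im hre him
  refine ⟨h10, ?_, ?_⟩
  · rw [h2, h10]; simp
  · rw [h10] at h1; linarith

theorem smul_eq_self_of_scalar {g : SL(2, ℝ)} (h10 : g 1 0 = 0) (h01 : g 0 1 = 0)
    (h : g 0 0 = g 1 1) (z : ℍ) : g • z = z := by
  apply UpperHalfPlane.ext
  have hd := g.det_coe
  rw [Matrix.det_fin_two, h10, h01, h] at hd
  have h11 : ((g 1 1 : ℝ) : ℂ) ≠ 0 := by
    intro h0
    have h0' : g 1 1 = 0 := by exact_mod_cast h0
    rw [h0'] at hd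
    simp at hd
  rw [coe_specialLinearGroup_apply]
  simp [h10, h01, h, mul_div_cancel_left₀ _ h11]

/-- The matrices which move a compact subset of the upper half plane to one that meets it have
bounded entries. -/
theorem exists_bound_of_smul_mem {V : Set ℍ} (hV : IsCompact V) :
    ∃ C : ℝ, ∀ g : SL(2, ℝ), ∀ w ∈ V, g • w ∈ V → ∀ i j, |g i j| ≤ C := by
  -- Properness of `(g, w) ↦ (g • w, w)` makes the set of relevant pairs compact, and matrix entries
  -- are continuous on it.
  have hc : IsCompact ((fun p : SL(2, ℝ) × ℍ => (p.1 • p.2, p.2)) ⁻¹' (V ×ˢ V)) :=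
    (ProperSMul.isProperMap_smul_pair (G := SL(2, ℝ)) (X := ℍ)).isCompact_preimage (hV.prod hV)
  have hb : ∀ i j : Fin 2, ∃ C : ℝ, ∀ g : SL(2, ℝ), ∀ w ∈ V, g • w ∈ V → |g i j| ≤ C := by
    intro i j
    have hcont : Continuous fun p : SL(2, ℝ) × ℍ => (p.1 : Matrix (Fin 2) (Fin 2) ℝ) i j :=
      (continuous_subtype_val.comp continuous_fst).matrix_elem i j
    obtain ⟨C, hC⟩ := hc.exists_bound_of_continuousOn hcont.continuousOn
    exact ⟨C, fun g w hw hgw => hC (g, w) ⟨hgw, hw⟩⟩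
  choose C hC using hb
  refine ⟨∑ i, ∑ j, |C i j|, fun g w hw hgw i j => ?_⟩
  calc |g i j| ≤ |C i j| := (hC i j g w hw hgw).trans (le_abs_self _)
    _ ≤ ∑ j, |C i j| := Finset.single_le_sum (f := fun j => |C i j|)
        (fun _ _ => abs_nonneg _) (Finset.mem_univ j)
    _ ≤ _ := Finset.single_le_sum (f := fun i => ∑ j, |C i j|)
        (fun _ _ => Finset.sum_nonneg fun _ _ => abs_nonneg _) (Finset.mem_univ i)

end UpperHalfPlaneLemmas

/-! ### The action on the product through two real embeddings. -/

section Action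

variable {K : Type*} [Field K] (ι₁ ι₂ : K →+* ℝ)

/-- The action of `GL₂(K)` on `ℍ × ℍ` through two real embeddings. -/
noncomputable def glActionHom : GL (Fin 2) K →* Equiv.Perm (ℍ × ℍ) where
  toFun g := Equiv.prodCongr
    (MulAction.toPerm (Matrix.GeneralLinearGroup.map ι₁ g : GL (Fin 2) ℝ))
    (MulAction.toPerm (Matrix.GeneralLinearGroup.map ι₂ g : GL (Fin 2) ℝ))
  map_one' := by
    ext z <;> simp
  map_mul' g h := by
    ext z <;> simp [mul_smul]

theorem glActionHom_apply (g : GL (Fin 2) K) (z : ℍ × ℍ) :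
    glActionHom ι₁ ι₂ g z = (Matrix.GeneralLinearGroup.map ι₁ g • z.1,
      Matrix.GeneralLinearGroup.map ι₂ g • z.2) := rfl

theorem actionHom_apply (g : SL(2, K)) (z : ℍ × ℍ) :
    actionHom ι₁ ι₂ g z = (Matrix.SpecialLinearGroup.map ι₁ g • z.1,
      Matrix.SpecialLinearGroup.map ι₂ g • z.2) := rfl

theorem glActionHom_coe (g : SL(2, K)) :
    glActionHom ι₁ ι₂ (g : GL (Fin 2) K) = actionHom ι₁ ι₂ g := by
  have h : ∀ ι : K →+* ℝ, Matrix.GeneralLinearGroup.map ι (g : GL (Fin 2) K) =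
      Matrix.SpecialLinearGroup.mapGL ℝ (Matrix.SpecialLinearGroup.map ι g) := by
    intro ι
    ext i j
    rfl
  refine Equiv.ext fun z => ?_
  rw [glActionHom_apply, h, h]
  rfl

theorem measurePreserving_glActionHom (g : GL (Fin 2) K) :
    MeasurePreserving (glActionHom ι₁ ι₂ g) gaussBonnetMeasure gaussBonnetMeasure := by
  unfold gaussBonnetMeasure
  exact ((measurePreserving_smul (Matrix.GeneralLinearGroup.map ι₁ g) (volume : Measure ℍ)).prod
    (measurePreserving_smul (Matrix.GeneralLinearGroup.map ι₂ g) (volume : Measure ℍ))).smul_measure _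

theorem continuous_actionHom (g : SL(2, K)) : Continuous (actionHom ι₁ ι₂ g) :=
  ((continuous_const_smul (Matrix.SpecialLinearGroup.map ι₁ g)).comp continuous_fst).prodMk
    ((continuous_const_smul (Matrix.SpecialLinearGroup.map ι₂ g)).comp continuous_snd)

theorem measurePreserving_actionHom (g : SL(2, K)) :
    MeasurePreserving (actionHom ι₁ ι₂ g) gaussBonnetMeasure gaussBonnetMeasure :=
  glActionHom_coe ι₁ ι₂ g ▸ measurePreserving_glActionHom ι₁ ι₂ g

instance instMeasurableConstSMulMap (Γ : Subgroup SL(2, K)) :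
    MeasurableConstSMul (Γ.map (actionHom ι₁ ι₂)) (ℍ × ℍ) where
  measurable_const_smul := by
    rintro ⟨_, g, hg, rfl⟩
    exact (continuous_actionHom ι₁ ι₂ g).measurable

instance instSMulInvariantMeasureMap (Γ : Subgroup SL(2, K)) :
    SMulInvariantMeasure (Γ.map (actionHom ι₁ ι₂)) (ℍ × ℍ) gaussBonnetMeasure where
  measure_preimage_smul := by
    rintro ⟨_, g, hg, rfl⟩ s hs
    exact (measurePreserving_actionHom ι₁ ι₂ g).measure_preimage hs.nullMeasurableSet

theorem scalar_iff_eq_one_or_neg_one (g : SL(2, K)) :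
    (g 1 0 = 0 ∧ g 0 1 = 0 ∧ g 0 0 = g 1 1) ↔ g = 1 ∨ g = -1 := by
  constructor
  · rintro ⟨h1, h2, h3⟩
    have hd := g.det_coe
    rw [Matrix.det_fin_two, h1, h2, ← h3] at hd
    have : g 0 0 = 1 ∨ g 0 0 = -1 := mul_self_eq_one_iff.1 (by linear_combination hd)
    rcases this with h | h
    · left; ext i j; fin_cases i <;> fin_cases j <;> simp [h1, h2, h, ← h3]
    · right; ext i j; fin_cases i <;> fin_cases j <;> simp [h1, h2, h, ← h3]
  · rintro (rfl | rfl) <;> simp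

theorem actionHom_eq_one_of_scalar {g : SL(2, K)} (h10 : g 1 0 = 0) (h01 : g 0 1 = 0)
    (h : g 0 0 = g 1 1) : actionHom ι₁ ι₂ g = 1 := by
  apply Equiv.ext
  intro z
  rw [actionHom_apply, smul_eq_self_of_scalar (by simp [h10]) (by simp [h01]) (by simp [h]),
    smul_eq_self_of_scalar (by simp [h10]) (by simp [h01]) (by simp [h])]
  rfl

theorem scalar_of_map_scalar {g : SL(2, K)}
    (h : (Matrix.SpecialLinearGroup.map ι₁ g) 1 0 = 0 ∧ (Matrix.SpecialLinearGroup.map ι₁ g) 0 1 = 0 ∧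
      (Matrix.SpecialLinearGroup.map ι₁ g) 0 0 = (Matrix.SpecialLinearGroup.map ι₁ g) 1 1) :
    g 1 0 = 0 ∧ g 0 1 = 0 ∧ g 0 0 = g 1 1 := by
  simpa [ι₁.injective.eq_iff] using h

/-- A matrix acting trivially fixes both `i` and `1 + i` in the first factor, so it is scalar, hence
`±1`. This lets intersections and indices be computed in `SL₂(K)`. -/
theorem ker_actionHom_le {Γ : Subgroup SL(2, K)} (h : -1 ∈ Γ) : (actionHom ι₁ ι₂).ker ≤ Γ := by
  intro g hg
  have hg' : ∀ z, actionHom ι₁ ι₂ g z = z := fun z => by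
    rw [MonoidHom.mem_ker.1 hg]; rfl
  have hne : UpperHalfPlane.I ≠ (1 : ℝ) +ᵥ UpperHalfPlane.I := by
    intro h
    have := congrArg UpperHalfPlane.re h
    simp at this
  have hs := scalar_of_smul_eq_self hne
    (congrArg Prod.fst (hg' (UpperHalfPlane.I, UpperHalfPlane.I)))
    (congrArg Prod.fst (hg' ((1 : ℝ) +ᵥ UpperHalfPlane.I, UpperHalfPlane.I)))
  rcases (scalar_iff_eq_one_or_neg_one g).1 (scalar_of_map_scalar ι₁ hs) with rfl | rfl
  · exact Γ.one_mem
  · exact h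

/-- Two fixed points in the first factor would force a scalar matrix, so the fixed points lie in
`{pt} × ℍ`. -/
theorem ae_actionHom_ne {g : SL(2, K)} (hg : actionHom ι₁ ι₂ g ≠ 1) :
    ∀ᵐ z ∂gaussBonnetMeasure, actionHom ι₁ ι₂ g z ≠ z := by
  unfold gaussBonnetMeasure
  refine Measure.ae_smul_measure ?_ _
  let T : Set ℍ := {z | Matrix.SpecialLinearGroup.map ι₁ g • z = z}
  have hT : T.Subsingleton := by
    intro z hz w hw
    by_contra hzw
    obtain ⟨h1, h2, h3⟩ := scalar_of_map_scalar ι₁ (scalar_of_smul_eq_self hzw hz hw)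
    exact hg (actionHom_eq_one_of_scalar ι₁ ι₂ h1 h2 h3)
  have hT0 : volume T = 0 := by
    rcases hT.eq_empty_or_singleton with h | ⟨z, h⟩
    · rw [h]; simp
    · rw [h]; exact volume_upperHalfPlane_singleton z
  rw [ae_iff]
  refine measure_mono_null (t := T ×ˢ univ) ?_ ?_
  · intro z hz
    simp only [ne_eq, not_not, mem_ofPred_eq] at hz
    exact ⟨congrArg Prod.fst hz, mem_univ _⟩
  · rw [Measure.volume_eq_prod, Measure.prod_prod, hT0, zero_mul]

end Action

end HilbertModular

namespace HilbertModular

open MeasureTheory Set Topology Pointwise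

/-! ### Proper discontinuity. -/

section Discreteness

variable {K : Type*} [Field K] {ι₁ ι₂ : K →+* ℝ} {sqrtD : K}

/-- The entries of the matrices in `Γ` lie in `m⁻¹ ℤ[√D]` for some integer `m ≠ 0`. -/
def HasBoundedDenominators (sqrtD : K) (Γ : Subgroup SL(2, K)) : Prop :=
  ∃ m : ℤ, m ≠ 0 ∧ ∀ g ∈ Γ, ∀ i j, ∃ u v : ℤ, (m : K) * g i j = u + v * sqrtD

/-- The two embeddings of `m x` are `u + v s` and `u - v s`; bounding both bounds the integers `u`
and `v`. -/
theorem finite_bounded_elements (hs : ι₁ sqrtD ≠ 0) (hι : ι₂ sqrtD = -ι₁ sqrtD) {m : ℤ}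
    (hm : m ≠ 0) (C : ℝ) :
    {x : K | (∃ u v : ℤ, (m : K) * x = u + v * sqrtD) ∧ |ι₁ x| ≤ C ∧ |ι₂ x| ≤ C}.Finite := by
  have hmK : (m : K) ≠ 0 := fun h => hm (by
    have := congrArg ι₁ h
    simpa using this)
  obtain ⟨B, hB⟩ := exists_nat_ge (|(m : ℝ)| * C)
  obtain ⟨B', hB'⟩ := exists_nat_ge (|(m : ℝ)| * C / |ι₁ sqrtD|)
  refine (((finite_Icc (-(B : ℤ)) B).prod (finite_Icc (-(B' : ℤ)) B')).image
    fun p : ℤ × ℤ => ((p.1 : K) + p.2 * sqrtD) / m).subset ?_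
  rintro x ⟨⟨u, v, huv⟩, h1, h2⟩
  have e1 := congrArg ι₁ huv
  have e2 := congrArg ι₂ huv
  simp only [map_mul, map_add, map_intCast, hι] at e1 e2
  have b1 : |(m : ℝ) * ι₁ x| ≤ |(m : ℝ)| * C := by
    rw [abs_mul]; exact mul_le_mul_of_nonneg_left h1 (abs_nonneg _)
  have b2 : |(m : ℝ) * ι₂ x| ≤ |(m : ℝ)| * C := by
    rw [abs_mul]; exact mul_le_mul_of_nonneg_left h2 (abs_nonneg _)
  rw [e1, abs_le] at b1
  rw [e2, abs_le] at b2
  have bu : |(u : ℝ)| ≤ B := (abs_le.2 ⟨by linarith, by linarith⟩ : |(u : ℝ)| ≤ |(m : ℝ)| * C).trans hB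
  have bv : |(v : ℝ)| ≤ B' := by
    refine le_trans ?_ hB'
    rw [le_div_iff₀ (abs_pos.2 hs), ← abs_mul]
    exact abs_le.2 ⟨by linarith, by linarith⟩
  refine ⟨(u, v), ⟨?_, ?_⟩, ?_⟩
  · rw [abs_le] at bu; exact ⟨by exact_mod_cast bu.1, by exact_mod_cast bu.2⟩
  · rw [abs_le] at bv; exact ⟨by exact_mod_cast bv.1, by exact_mod_cast bv.2⟩
  · simp only
    rw [← huv, mul_div_cancel_left₀ _ hmK]

/-- Compactness bounds every entry under both embeddings, and bounded denominators leave finitely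
many such entries. -/
theorem finite_actionHom_mem (hs : ι₁ sqrtD ≠ 0) (hι : ι₂ sqrtD = -ι₁ sqrtD)
    {Γ : Subgroup SL(2, K)} (hΓ : HasBoundedDenominators sqrtD Γ) {V W : Set ℍ} (hV : IsCompact V)
    (hW : IsCompact W) :
    {g : SL(2, K) | g ∈ Γ ∧ ∃ z ∈ V ×ˢ W, actionHom ι₁ ι₂ g z ∈ V ×ˢ W}.Finite := by
  obtain ⟨m, hm, hmΓ⟩ := hΓ
  obtain ⟨C₁, hC₁⟩ := exists_bound_of_smul_mem hV
  obtain ⟨C₂, hC₂⟩ := exists_bound_of_smul_mem hW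
  have hfin := finite_bounded_elements hs hι hm (max C₁ C₂)
  refine Finite.of_finite_image (f := fun g : SL(2, K) => fun i j => g i j) ?_
    (fun g _ h _ e => Matrix.SpecialLinearGroup.ext g h fun i j => congrFun (congrFun e i) j)
  refine (Set.Finite.pi' fun _ : Fin 2 => Set.Finite.pi' fun _ : Fin 2 => hfin).subset ?_
  rintro _ ⟨g, ⟨hg, z, hz, hgz⟩, rfl⟩ i j
  refine ⟨hmΓ g hg i j, ?_, ?_⟩
  · exact (hC₁ (Matrix.SpecialLinearGroup.map ι₁ g) z.1 hz.1 hgz.1 i j).trans (le_max_left _ _)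
  · exact (hC₂ (Matrix.SpecialLinearGroup.map ι₂ g) z.2 hz.2 hgz.2 i j).trans (le_max_right _ _)

/-- A point which is fixed by no non-trivial transformation has a neighbourhood disjoint from its
translates. -/
theorem exists_wandering_nhd (hs : ι₁ sqrtD ≠ 0) (hι : ι₂ sqrtD = -ι₁ sqrtD)
    {Γ : Subgroup SL(2, K)} (hΓ : HasBoundedDenominators sqrtD Γ) {z : ℍ × ℍ}
    (hz : ∀ γ : Γ.map (actionHom ι₁ ι₂), γ ≠ 1 → γ • z ≠ z) :
    ∃ U : Set (ℍ × ℍ), IsOpen U ∧ z ∈ U ∧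
      ∀ γ : Γ.map (actionHom ι₁ ι₂), γ ≠ 1 → ∀ y ∈ U, γ • y ∉ U := by
  obtain ⟨V, hV, hzV⟩ := exists_compact_mem_nhds z.1
  obtain ⟨W, hW, hzW⟩ := exists_compact_mem_nhds z.2
  have hfin : {γ : Γ.map (actionHom ι₁ ι₂) | ∃ y ∈ V ×ˢ W, γ • y ∈ V ×ˢ W}.Finite := by
    refine Finite.of_finite_image (f := Subtype.val) ?_ Subtype.val_injective.injOn
    refine ((finite_actionHom_mem hs hι hΓ hV hW).image (actionHom ι₁ ι₂)).subset ?_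
    rintro _ ⟨⟨_, g, hg, rfl⟩, ⟨y, hy, hgy⟩, rfl⟩
    exact ⟨g, ⟨hg, y, hy, hgy⟩, rfl⟩
  have hsep : ∀ γ : Γ.map (actionHom ι₁ ι₂), γ ≠ 1 → ∃ U : Set (ℍ × ℍ), U ∈ 𝓝 z ∧
      ∀ y ∈ U, γ • y ∉ U := by
    intro γ hγ
    obtain ⟨A, B, hA, hB, hzA, hzB, hAB⟩ := t2_separation (hz γ hγ)
    have hcont : Continuous fun y : ℍ × ℍ => γ • y := by
      obtain ⟨_, g, hg, rfl⟩ := γ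
      exact continuous_actionHom ι₁ ι₂ g
    refine ⟨B ∩ (fun y => γ • y) ⁻¹' A, Filter.inter_mem (hB.mem_nhds hzB)
      ((hA.preimage hcont).mem_nhds hzA), fun y hy hy' => ?_⟩
    exact disjoint_left.1 hAB hy.2 hy'.1
  choose! N hN hN' using hsep
  -- Only finitely many `γ` fail to move `V ×ˢ W` off itself; for these, intersect with separating
  -- neighbourhoods.
  let U := interior ((V ×ˢ W) ∩
    ⋂ γ ∈ {γ : Γ.map (actionHom ι₁ ι₂) | ∃ y ∈ V ×ˢ W, γ • y ∈ V ×ˢ W} \ {1}, N γ)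
  have hU : ∀ y ∈ U, y ∈ (V ×ˢ W) ∩
    ⋂ γ ∈ {γ : Γ.map (actionHom ι₁ ι₂) | ∃ y ∈ V ×ˢ W, γ • y ∈ V ×ˢ W} \ {1}, N γ :=
    fun y hy => interior_subset hy
  refine ⟨U, isOpen_interior, mem_interior_iff_mem_nhds.2 (Filter.inter_mem ?_ ?_), ?_⟩
  · rw [nhds_prod_eq]; exact Filter.prod_mem_prod hzV hzW
  · exact (Filter.biInter_mem (hfin.subset sdiff_subset)).2 fun γ hγ => hN γ hγ.2
  · intro γ hγ y hy hgy
    have hmem : γ ∈ {γ : Γ.map (actionHom ι₁ ι₂) | ∃ y ∈ V ×ˢ W, γ • y ∈ V ×ˢ W} \ {1} :=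
      ⟨⟨y, (hU y hy).1, (hU _ hgy).1⟩, hγ⟩
    exact hN' γ hγ y (mem_iInter₂.1 (hU y hy).2 γ hmem) (mem_iInter₂.1 (hU _ hgy).2 γ hmem)

theorem countable_map_actionHom [Countable K] (ι₁ ι₂ : K →+* ℝ) (Γ : Subgroup SL(2, K)) :
    Countable (Γ.map (actionHom ι₁ ι₂)) := by
  have : Countable (Matrix (Fin 2) (Fin 2) K) := inferInstanceAs (Countable (Fin 2 → Fin 2 → K))
  have : Countable SL(2, K) := Subtype.countable
  exact ((to_countable (Γ : Set SL(2, K))).image (actionHom ι₁ ι₂)).to_subtype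

theorem exists_isFundamentalDomain_map [Countable K] (hs : ι₁ sqrtD ≠ 0)
    (hι : ι₂ sqrtD = -ι₁ sqrtD) {Γ : Subgroup SL(2, K)} (hΓ : HasBoundedDenominators sqrtD Γ) :
    ∃ s, IsFundamentalDomain (Γ.map (actionHom ι₁ ι₂)) s gaussBonnetMeasure := by
  have := countable_map_actionHom ι₁ ι₂ Γ
  apply exists_isFundamentalDomain
  have hae : ∀ᵐ z ∂gaussBonnetMeasure, ∀ γ : Γ.map (actionHom ι₁ ι₂), γ ≠ 1 → γ • z ≠ z := by
    rw [ae_all_iff]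
    rintro ⟨_, g, hg, rfl⟩
    by_cases h1 : actionHom ι₁ ι₂ g = 1
    · exact Filter.Eventually.of_forall fun z hne => absurd (Subtype.ext h1) hne
    · filter_upwards [ae_actionHom_ne ι₁ ι₂ h1] with z hz _ using hz
  filter_upwards [hae] with z hz using exists_wandering_nhd hs hι hΓ hz

end Discreteness

end HilbertModular

namespace HilbertModular

open MeasureTheory Set Topology Pointwise

/-! ### Volumes of half strips. -/

section Strips

/-- A half strip in the upper half plane. -/
def halfStrip (C η : ℝ) : Set ℍ := {z | |z.re| ≤ C ∧ η ≤ z.im}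

theorem measurableSet_halfStrip (C η : ℝ) : MeasurableSet (halfStrip C η) :=
  ((isClosed_le (UpperHalfPlane.continuous_re.abs) continuous_const).inter
    (isClosed_le continuous_const UpperHalfPlane.continuous_im)).measurableSet

/-- The area is the width times the integral of `y⁻²` over `[η, ∞)`. -/
theorem volume_halfStrip_lt_top (C : ℝ) {η : ℝ} (hη : 0 < η) : volume (halfStrip C η) < ⊤ := by
  rw [UpperHalfPlane.volume_eq_lintegral]
  let f : ℝ → ENNReal := fun y => ↑((1 / ‖y‖₊) ^ 2 : NNReal)
  have hf : Measurable f := by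
    refine measurable_coe_nnreal_ennreal.comp ?_
    exact (measurable_const.div measurable_nnnorm).pow_const 2
  have hsub : UpperHalfPlane.coe '' halfStrip C η ⊆
      Complex.measurableEquivRealProd ⁻¹' (Icc (-C) C ×ˢ Ici η) := by
    rintro _ ⟨z, ⟨h1, h2⟩, rfl⟩
    exact ⟨abs_le.1 h1, h2⟩
  refine (lintegral_mono_set hsub).trans_lt ?_
  have hpre := Complex.volume_preserving_equiv_real_prod.setLIntegral_comp_preimage
    (s := Icc (-C) C ×ˢ Ici η) (measurableSet_Icc.prod measurableSet_Ici)
    (f := fun p : ℝ × ℝ => f p.2) (hf.comp measurable_snd)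
  have e : ∫⁻ z : ℂ in Complex.measurableEquivRealProd ⁻¹' (Icc (-C) C ×ˢ Ici η),
      ↑((1 / ‖z.im‖₊) ^ 2 : NNReal) = ∫⁻ p : ℝ × ℝ in Icc (-C) C ×ˢ Ici η, f p.2 := hpre
  rw [e, Measure.volume_eq_prod, ← Measure.prod_restrict]
  have hprod := lintegral_prod_mul (μ := volume.restrict (Icc (-C) C))
    (ν := volume.restrict (Ici η)) (f := fun _ => 1) (g := f) aemeasurable_const hf.aemeasurable
  simp only [one_mul] at hprod
  rw [hprod]
  refine ENNReal.mul_lt_top ?_ ?_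
  · simp
  · have hint : IntegrableOn (fun y : ℝ => y ^ (-2 : ℝ)) (Ici η) :=
      (integrableOn_Ici_iff_integrableOn_Ioi (by simp)).2 (integrableOn_Ioi_rpow_of_lt (by norm_num) hη)
    refine lt_of_le_of_lt (le_of_eq ?_) hint.2
    refine setLIntegral_congr_fun measurableSet_Ici fun y hy => ?_
    have hy0 : 0 < y := hη.trans_le hy
    simp only [f]
    rw [enorm_eq_nnnorm]
    congr 1
    ext
    rw [NNReal.coe_pow, NNReal.coe_div, coe_nnnorm, coe_nnnorm, NNReal.coe_one, Real.norm_of_nonneg hy0.le,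
      Real.norm_of_nonneg (by positivity), Real.rpow_neg hy0.le, Real.rpow_two, one_div, inv_pow]

theorem gaussBonnetMeasure_halfStrip_lt_top (C : ℝ) {η : ℝ} (hη : 0 < η) :
    gaussBonnetMeasure (halfStrip C η ×ˢ halfStrip C η) < ⊤ := by
  rw [gaussBonnetMeasure, Measure.smul_apply, Measure.volume_eq_prod, Measure.prod_prod, smul_eq_mul]
  exact ENNReal.mul_lt_top ENNReal.ofReal_lt_top
    (ENNReal.mul_lt_top (volume_halfStrip_lt_top C hη) (volume_halfStrip_lt_top C hη))

/-- This gives a fundamental domain nonzero volume, so the ratio has a nonzero denominator. -/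
theorem gaussBonnetMeasure_ne_zero : gaussBonnetMeasure ≠ 0 := by
  have hv : (volume : Measure ℍ) ≠ 0 := by
    intro h
    have h1 : (volume : Measure ℍ) univ = 0 := by rw [h]; rfl
    rw [UpperHalfPlane.volume_eq_lintegral, image_univ, setLIntegral_eq_zero_iff
      UpperHalfPlane.measurableEmbedding_coe.measurableSet_range] at h1
    · have h2 : volume (range UpperHalfPlane.coe) = 0 := by
        rw [← compl_compl (range UpperHalfPlane.coe)]
        refine measure_mono_null ?_ (ae_iff.1 h1)
        rintro _ hz
        rw [compl_compl] at hz
        obtain ⟨z, rfl⟩ := hz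
        simp [z.im_pos, z.im_ne_zero]
      exact (UpperHalfPlane.isOpenEmbedding_coe.isOpen_range.measure_pos volume
        (range_nonempty _)).ne' h2
    · refine measurable_coe_nnreal_ennreal.comp ?_
      exact (measurable_const.div (measurable_nnnorm.comp Complex.measurable_im)).pow_const 2
  have hv' : (volume : Measure ℍ) univ ≠ 0 := by rwa [Ne, Measure.measure_univ_eq_zero]
  rw [← Measure.measure_univ_ne_zero, gaussBonnetMeasure, Measure.smul_apply, ← univ_prod_univ,
    Measure.volume_eq_prod, Measure.prod_prod, smul_eq_mul]
  refine mul_ne_zero ?_ (mul_ne_zero hv' hv')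
  rw [Ne, ENNReal.ofReal_eq_zero, not_le]
  positivity

end Strips

/-! ### Class number finiteness in `ℤ[√D]`. -/

section ZsqrtdAlgebra

variable {D : ℤ}

/-- The basis `1, √D` of `ℤ[√D]`. -/
noncomputable def zsqrtdBasis (D : ℤ) : Module.Basis (Fin 2) ℤ (ℤ√D) :=
  Module.Basis.ofEquivFun
    { toFun := fun x => ![x.re, x.im]
      invFun := fun v => ⟨v 0, v 1⟩
      map_add' := fun x y => by ext i; fin_cases i <;> simp
      map_smul' := fun c x => by ext i; fin_cases i <;> simp
      left_inv := fun x => by ext <;> simp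
      right_inv := fun v => by ext i; fin_cases i <;> simp }

theorem isDomain_zsqrtd (hD : ∀ n : ℤ, D ≠ n * n) : IsDomain (ℤ√D) := by
  have : NoZeroDivisors (ℤ√D) := ⟨by
    intro a b hab
    have := congrArg Zsqrtd.norm hab
    rwa [Zsqrtd.norm_mul, Zsqrtd.norm_zero, mul_eq_zero, Zsqrtd.norm_eq_zero hD,
      Zsqrtd.norm_eq_zero hD] at this⟩
  exact NoZeroDivisors.to_isDomain _

/-- In an ideal of `ℤ[√D]` with two generators there is an element that divides all elements,
up to a factor depending only on `D`. -/
theorem exists_bounded_gcd (hD : ∀ n : ℤ, D ≠ n * n) : ∃ n : ℤ, 0 < n ∧ ∀ c d : ℤ√D, (c ≠ 0 ∨ d ≠ 0) →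
    ∃ a b β c' d' : ℤ√D, β ≠ 0 ∧ a * d' - b * c' = n ∧ β * c' = n * c ∧ β * d' = n * d := by
  classical
  have hdom := isDomain_zsqrtd hD
  have halg : Algebra.IsAlgebraic ℤ (ℤ√D) := by
    have : Module.Finite ℤ (ℤ√D) := .of_basis (zsqrtdBasis D)
    infer_instance
  -- `T` is the finite set of multipliers of approximate division: for all `x` and `β ≠ 0` some `r ∈
  -- T` makes `r x` differ from a multiple of `β` by an element of smaller norm than `β`.
  let T := ClassGroup.finsetApprox (zsqrtdBasis D) AbsoluteValue.absIsAdmissible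
  have hT0 : (0 : ℤ) ∉ T := ClassGroup.finsetApprox.zero_notMem _ _
  have hprod : (∏ r ∈ T, r) ≠ 0 := Finset.prod_ne_zero_iff.2 fun r hr h => hT0 (h ▸ hr)
  refine ⟨|∏ r ∈ T, r|, abs_pos.2 hprod, fun c d hcd => ?_⟩
  let I : Ideal (ℤ√D) := Ideal.span {c, d}
  have hI : I ≠ ⊥ := by
    rw [Ne, Ideal.span_eq_bot]
    intro h
    rcases hcd with h' | h'
    · exact h' (h c (by simp))
    · exact h' (h d (by simp))
  -- With `β` of minimal norm in `I`, that remainder vanishes, so the product of `T` carries all of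
  -- `I` into `(β)`.
  obtain ⟨β, hβI, hβ0, hmin⟩ := ClassGroup.exists_min (S := ℤ√D) (abv := AbsoluteValue.abs)
    ⟨I, mem_nonZeroDivisors_of_ne_zero hI⟩
  have hdvd : ∀ x ∈ I, β ∣ ((|∏ r ∈ T, r| : ℤ) : ℤ√D) * x := by
    intro x hx
    obtain ⟨q, r, hr, hlt⟩ := ClassGroup.exists_mem_finset_approx' (zsqrtdBasis D)
      AbsoluteValue.absIsAdmissible x hβ0
    have h0 : r • x - q * β = 0 := hmin _ (I.sub_mem (I.smul_of_tower_mem r hx) (I.mul_mem_left q hβI)) hlt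
    have h1 : β ∣ (r : ℤ√D) * x := ⟨q, by
      rw [zsmul_eq_mul] at h0
      rw [mul_comm β, sub_eq_zero.1 h0]⟩
    have h2 : r ∣ |∏ r ∈ T, r| := (dvd_abs _ _).2 (Finset.dvd_prod_of_mem _ hr)
    obtain ⟨k, hk⟩ := h2
    rw [hk, Int.cast_mul, mul_comm (r : ℤ√D), mul_assoc]
    exact h1.mul_left _
  obtain ⟨p, q, hpq⟩ := Ideal.mem_span_pair.1 hβI
  obtain ⟨c', hc'⟩ := hdvd c (Ideal.subset_span (by simp))
  obtain ⟨d', hd'⟩ := hdvd d (Ideal.subset_span (by simp))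
  -- If `β = p c + q d`, then `β (q d' + p c') = n (q d + p c) = n β`.
  refine ⟨q, -p, β, c', d', hβ0, mul_left_cancel₀ hβ0 ?_, hc'.symm, hd'.symm⟩
  linear_combination -q * hd' - p * hc' + ((|∏ r ∈ T, r| : ℤ) : ℤ√D) * hpq

end ZsqrtdAlgebra

end HilbertModular

namespace HilbertModular

open MeasureTheory Set Topology Pointwise

/-! ### Minkowski's theorem and short vectors. -/

section ShortVectors

/-- Minkowski's theorem for linear forms. -/
theorem exists_int_linear_forms_le {ι : Type*} [Fintype ι] [DecidableEq ι] [Nonempty ι]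
    (A : Matrix ι ι ℝ) {b : ℝ} (hb : 0 ≤ b) (hdet : A.det ≠ 0)
    (h : |A.det| < b ^ Fintype.card ι) :
    ∃ v : ι → ℤ, v ≠ 0 ∧ ∀ i, |A.mulVec (fun j => (v j : ℝ)) i| ≤ b := by
  let S : Set (ι → ℝ) := (Matrix.toLin' A) ⁻¹' (Metric.closedBall 0 b)
  let E := Pi.basisFun ℝ ι
  have hS : volume S = ENNReal.ofReal |A.det⁻¹| * ENNReal.ofReal ((2 * b) ^ Fintype.card ι) := by
    rw [Measure.addHaar_preimage_linearMap _ (by rwa [LinearMap.det_toLin']), LinearMap.det_toLin',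
      Real.volume_pi_closedBall _ hb]
  have hF : volume (ZSpan.fundamentalDomain E) = 1 := by
    rw [ZSpan.fundamentalDomain_pi_basisFun, Real.volume_pi_Ico]
    simp
  have hlt : volume (ZSpan.fundamentalDomain E) * 2 ^ Module.finrank ℝ (ι → ℝ) < volume S := by
    rw [hF, hS, one_mul, Module.finrank_fintype_fun_eq_card, ← ENNReal.ofReal_mul (abs_nonneg _),
      ← ENNReal.ofReal_ofNat, ← ENNReal.ofReal_pow (by norm_num)]
    refine (ENNReal.ofReal_lt_ofReal_iff ?_).2 ?_
    · have : 0 < b ^ Fintype.card ι := (abs_pos.2 hdet).trans h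
      rw [mul_pow]
      have := abs_pos.2 (inv_ne_zero hdet)
      positivity
    · rw [mul_pow, abs_inv, ← mul_assoc, mul_comm _ ((2 : ℝ) ^ _), mul_assoc]
      refine lt_mul_of_one_lt_right (by positivity) ?_
      rw [inv_mul_eq_div, one_lt_div (abs_pos.2 hdet)]
      exact h
  have : Countable (Submodule.span ℤ (range E)).toAddSubgroup :=
    inferInstanceAs (Countable (Submodule.span ℤ (range E)))
  obtain ⟨x, hx0, hxS⟩ := exists_ne_zero_mem_lattice_of_measure_mul_two_pow_lt_measure
    (ZSpan.isAddFundamentalDomain' E volume) (s := S) (fun x hx => by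
      simp only [S, mem_preimage, mem_closedBall_zero_iff] at hx ⊢
      rwa [map_neg, norm_neg])
    ((convex_closedBall 0 b).linear_preimage _) hlt
  have hint := (E.mem_span_iff_repr_mem ℤ x.1).1 x.2
  choose v hv using hint
  have hvx : (fun j => (v j : ℝ)) = x.1 := by
    funext j
    simpa [E] using hv j
  refine ⟨v, ?_, fun i => ?_⟩
  · rintro rfl
    apply hx0
    apply Subtype.ext
    rw [← hvx]
    funext j
    simp
  · rw [hvx]
    have := mem_closedBall_zero_iff.1 hxS
    exact (norm_le_pi_norm (Matrix.toLin' A x.1) i).trans this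

/-- Minkowski's theorem is applied to the forms `√y c` and `(x c + d)/√y` at both places, in the
four integer coordinates of `(c, d)`. Their determinant `-4s²` does not depend on the point, and `|c
z + d|²` is `y` times the sum of the squares of the two forms. -/
theorem exists_short_pair (D : ℤ) {s : ℝ} (hs : s ≠ 0) : ∃ B : ℝ, 0 < B ∧ ∀ z₁ z₂ : ℍ, ∃ c d : ℤ√D,
    (c ≠ 0 ∨ d ≠ 0) ∧
    Complex.normSq (((c.re + c.im * s : ℝ) : ℂ) * z₁ + (d.re + d.im * s : ℝ)) ≤ B * z₁.im ∧
    Complex.normSq (((c.re - c.im * s : ℝ) : ℂ) * z₂ + (d.re - d.im * s : ℝ)) ≤ B * z₂.im := by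
  -- This choice gives `b ≥ 1` and `b > 2|s|`, so `b⁴` exceeds the determinant `4s²`.
  set b : ℝ := 1 + 2 * |s| with hb
  have habs := abs_pos.2 hs
  have hb1 : 1 ≤ b := by linarith
  refine ⟨2 * b ^ 2, by positivity, fun z₁ z₂ => ?_⟩
  have hy₁ := Real.sqrt_pos.2 z₁.im_pos
  have hy₂ := Real.sqrt_pos.2 z₂.im_pos
  let p := √z₁.im
  let q := √z₂.im
  let A : Matrix (Fin 4) (Fin 4) ℝ :=
    !![p, p * s, 0, 0; z₁.re / p, z₁.re / p * s, 1 / p, s / p;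
      q, -q * s, 0, 0; z₂.re / q, -z₂.re / q * s, 1 / q, -s / q]
  have hp : p ≠ 0 := hy₁.ne'
  have hq : q ≠ 0 := hy₂.ne'
  have hdet : A.det = -(2 * s) ^ 2 := by
    simp [A, Matrix.det_succ_row_zero, Fin.sum_univ_succ, Fin.succAbove]
    field_simp
    ring
  obtain ⟨v, hv0, hv⟩ := exists_int_linear_forms_le A (b := b) (by linarith)
    (by rw [hdet]; exact neg_ne_zero.2 (pow_ne_zero _ (by simpa using hs))) (by
      rw [hdet, abs_neg, abs_pow, abs_mul, abs_two, Fintype.card_fin]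
      calc (2 * |s|) ^ 2 < b ^ 2 := by gcongr; linarith
        _ ≤ b ^ 4 := pow_le_pow_right₀ hb1 (by norm_num))
  have key : ∀ (u w x r : ℝ) (z : ℍ), x = z.re → r ^ 2 = z.im → r ≠ 0 → |r * u| ≤ b → |(x * u + w) / r| ≤ b →
      Complex.normSq ((u : ℂ) * z + (w : ℂ)) ≤ 2 * b ^ 2 * z.im := by
    intro u w x r z hx hr hr0 h1 h2
    have h1' := sq_le_sq' (abs_le.1 h1).1 (abs_le.1 h1).2
    have h2' := sq_le_sq' (abs_le.1 h2).1 (abs_le.1 h2).2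
    have hr2 : 0 < r ^ 2 := by positivity
    rw [div_pow, div_le_iff₀ hr2] at h2'
    rw [Complex.normSq_apply]
    simp only [Complex.add_re, Complex.mul_re, Complex.ofReal_re, Complex.ofReal_im, zero_mul, sub_zero,
      Complex.add_im, Complex.mul_im, add_zero, UpperHalfPlane.coe_re, UpperHalfPlane.coe_im]
    rw [← hr, ← hx]
    nlinarith [mul_le_mul_of_nonneg_right h1' hr2.le]
  refine ⟨⟨v 0, v 1⟩, ⟨v 2, v 3⟩, ?_, ?_, ?_⟩
  · by_contra! hcon
    obtain ⟨h1, h2⟩ := hcon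
    rw [Zsqrtd.ext_iff] at h1 h2
    apply hv0
    funext i
    fin_cases i
    · exact h1.1
    · exact h1.2
    · exact h2.1
    · exact h2.2
  · refine key _ _ z₁.re p z₁ rfl (Real.sq_sqrt z₁.im_pos.le) hp (le_of_eq_of_le ?_ (hv 0)) (le_of_eq_of_le ?_ (hv 1))
    · congr 1
      simp [A, Matrix.mulVec, dotProduct, Fin.sum_univ_succ]
      ring_nf
    · simp [A, Matrix.mulVec, dotProduct, Fin.sum_univ_succ]
      ring_nf
  · refine key _ _ z₂.re q z₂ rfl (Real.sq_sqrt z₂.im_pos.le) hq (le_of_eq_of_le ?_ (hv 2)) (le_of_eq_of_le ?_ (hv 3))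
    · congr 1
      simp [A, Matrix.mulVec, dotProduct, Fin.sum_univ_succ]
      ring_nf
    · simp [A, Matrix.mulVec, dotProduct, Fin.sum_univ_succ]
      ring_nf

end ShortVectors

end HilbertModular

namespace HilbertModular

open MeasureTheory Set Topology Pointwise

/-! ### Moving points away from the boundary. -/

section Reduction

variable {K : Type*} [Field K] {ι₁ ι₂ : K →+* ℝ} {sqrtD : K} {D : ℤ}

/-- The embedding of `ℤ[√D]` in a field with a square root of `D`. -/
noncomputable def zsqrtdHom (hsqrt : sqrtD ^ 2 = (D : K)) : ℤ√D →+* K :=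
  Zsqrtd.lift ⟨sqrtD, by rw [← sq, hsqrt]⟩

theorem zsqrtdHom_apply (hsqrt : sqrtD ^ 2 = (D : K)) (x : ℤ√D) :
    zsqrtdHom hsqrt x = x.re + x.im * sqrtD := rfl

theorem embedding_mul_embedding (hsqrt : sqrtD ^ 2 = (D : K)) (hι : ι₂ sqrtD = -ι₁ sqrtD) (x : ℤ√D) :
    ι₁ (zsqrtdHom hsqrt x) * ι₂ (zsqrtdHom hsqrt x) = x.norm := by
  have h := congrArg ι₁ hsqrt
  simp only [map_pow, map_intCast] at h
  simp only [zsqrtdHom_apply, map_add, map_mul, map_intCast, hι, Zsqrtd.norm_def]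
  push_cast
  linear_combination -(x.im : ℝ) ^ 2 * h

/-- A matrix over `ℤ[√D]` of non-zero determinant as an element of `GL₂(K)`. -/
noncomputable def zsqrtdGL (hsqrt : sqrtD ^ 2 = (D : K)) (M : Matrix (Fin 2) (Fin 2) (ℤ√D))
    (h : ((zsqrtdHom hsqrt) M.det) ≠ 0) : GL (Fin 2) K :=
  Matrix.GeneralLinearGroup.mkOfDetNeZero (M.map (zsqrtdHom hsqrt)) (by
    rwa [← RingHom.mapMatrix_apply, ← RingHom.map_det])

theorem map_zsqrtdGL_apply (hsqrt : sqrtD ^ 2 = (D : K)) (M : Matrix (Fin 2) (Fin 2) (ℤ√D))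
    (h : ((zsqrtdHom hsqrt) M.det) ≠ 0) (ι : K →+* ℝ) (i j : Fin 2) :
    Matrix.GeneralLinearGroup.map ι (zsqrtdGL hsqrt M h) i j = ι (zsqrtdHom hsqrt (M i j)) := rfl

theorem det_map_zsqrtdGL (hsqrt : sqrtD ^ 2 = (D : K)) (M : Matrix (Fin 2) (Fin 2) (ℤ√D))
    (h : ((zsqrtdHom hsqrt) M.det) ≠ 0) (ι : K →+* ℝ) :
    (Matrix.GeneralLinearGroup.map ι (zsqrtdGL hsqrt M h)).det.val = ι (zsqrtdHom hsqrt M.det) := by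
  rw [Matrix.GeneralLinearGroup.val_det_apply, Matrix.det_fin_two, Matrix.det_fin_two]
  simp only [map_zsqrtdGL_apply, map_sub, map_mul]

theorem zsqrtdGL_mul (hsqrt : sqrtD ^ 2 = (D : K)) (M M' : Matrix (Fin 2) (Fin 2) (ℤ√D)) (h h' h'') :
    zsqrtdGL hsqrt (M * M') h'' = zsqrtdGL hsqrt M h * zsqrtdGL hsqrt M' h' := by
  apply Units.ext
  exact Matrix.map_mul

theorem zsqrtdHom_intCast_ne_zero [CharZero K] (hsqrt : sqrtD ^ 2 = (D : K)) {n : ℤ} (hn : 0 < n)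
    {x : ℤ√D} (hx : x = n) : zsqrtdHom hsqrt x ≠ 0 := by
  rw [hx, map_intCast]
  exact_mod_cast hn.ne'

/-- Every point can be moved far away from the boundary by a matrix of fixed determinant. -/
theorem exists_le_im_mul_im [CharZero K] (hsqrt : sqrtD ^ 2 = (D : K)) (hD : ∀ n : ℤ, D ≠ n * n)
    (hs : ι₁ sqrtD ≠ 0) (hι : ι₂ sqrtD = -ι₁ sqrtD) :
    ∃ n : ℤ, 0 < n ∧ ∃ κ : ℝ, 0 < κ ∧ ∀ z : ℍ × ℍ, ∃ M : Matrix (Fin 2) (Fin 2) (ℤ√D),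
      M.det = n ∧ ∃ h, κ ≤ (glActionHom ι₁ ι₂ (zsqrtdGL hsqrt M h) z).1.im *
        (glActionHom ι₁ ι₂ (zsqrtdGL hsqrt M h) z).2.im := by
  obtain ⟨n, hn, hgcd⟩ := exists_bounded_gcd hD
  obtain ⟨B, hB, hshort⟩ := exists_short_pair D hs
  have hnR : (0 : ℝ) < n := by exact_mod_cast hn
  -- The product of imaginary parts is `n² y₁ y₂ / (N₁ N₂)`, while `N₁ N₂ ≤ n⁴ B² y₁ y₂`.
  refine ⟨n, hn, 1 / (n * B) ^ 2, by positivity, fun z => ?_⟩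
  obtain ⟨c, d, hcd, h1, h2⟩ := hshort z.1 z.2
  obtain ⟨a, b, β, c', d', hβ, hdet, hc', hd'⟩ := hgcd c d hcd
  have hMdet : (!![a, b; c', d']).det = (n : ℤ√D) := by rw [Matrix.det_fin_two_of, hdet]
  have hM0 := zsqrtdHom_intCast_ne_zero hsqrt hn hMdet
  refine ⟨!![a, b; c', d'], hMdet, hM0, ?_⟩
  set g := zsqrtdGL hsqrt !![a, b; c', d'] hM0 with hg
  have key : ∀ (ι : K →+* ℝ) (w : ℍ),
      ι (zsqrtdHom hsqrt β) ^ 2 * Complex.normSq (UpperHalfPlane.denom (Matrix.GeneralLinearGroup.map ι g) w)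
      = n ^ 2 * Complex.normSq ((ι (zsqrtdHom hsqrt c) : ℂ) * w + ι (zsqrtdHom hsqrt d)) := by
    intro ι w
    have e1 := congrArg (fun x => ((ι (zsqrtdHom hsqrt x) : ℝ) : ℂ)) hc'
    have e2 := congrArg (fun x => ((ι (zsqrtdHom hsqrt x) : ℝ) : ℂ)) hd'
    simp only [map_mul, map_intCast, Complex.ofReal_mul, Complex.ofReal_intCast] at e1 e2
    have e3 : ((ι (zsqrtdHom hsqrt β) : ℝ) : ℂ) * UpperHalfPlane.denom (Matrix.GeneralLinearGroup.map ι g) w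
        = ((n : ℝ) : ℂ) * ((ι (zsqrtdHom hsqrt c) : ℂ) * w + ι (zsqrtdHom hsqrt d)) := by
      have : UpperHalfPlane.denom (Matrix.GeneralLinearGroup.map ι g) w =
        (ι (zsqrtdHom hsqrt c') : ℂ) * w + ι (zsqrtdHom hsqrt d') := rfl
      rw [this]
      push_cast
      linear_combination (w : ℂ) * e1 + e2
    have e4 := congrArg Complex.normSq e3
    rw [map_mul, map_mul, Complex.normSq_ofReal, Complex.normSq_ofReal] at e4
    rw [sq, sq, e4]
  have k1 := key ι₁ z.1
  have k2 := key ι₂ z.2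
  have hr1 : ι₁ (zsqrtdHom hsqrt c) = c.re + c.im * ι₁ sqrtD ∧
      ι₁ (zsqrtdHom hsqrt d) = d.re + d.im * ι₁ sqrtD := by
    constructor <;> simp [zsqrtdHom_apply]
  have hr2 : ι₂ (zsqrtdHom hsqrt c) = c.re - c.im * ι₁ sqrtD ∧
      ι₂ (zsqrtdHom hsqrt d) = d.re - d.im * ι₁ sqrtD := by
    constructor <;> simp [zsqrtdHom_apply, hι, sub_eq_add_neg]
  rw [← hr1.1, ← hr1.2] at h1
  rw [← hr2.1, ← hr2.2] at h2
  -- The norm of `β` is a nonzero integer, so dividing `n (c, d)` by `β` does not increase the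
  -- product of the two denominators.
  have hN : (1 : ℝ) ≤ (ι₁ (zsqrtdHom hsqrt β) ^ 2) * (ι₂ (zsqrtdHom hsqrt β) ^ 2) := by
    rw [← mul_pow, embedding_mul_embedding hsqrt hι]
    have : β.norm ≠ 0 := fun h => hβ ((Zsqrtd.norm_eq_zero hD β).1 h)
    have h1 : 1 ≤ β.norm ^ 2 := by have := sq_pos_of_ne_zero this; omega
    exact_mod_cast h1
  change _ ≤ (Matrix.GeneralLinearGroup.map ι₁ g • z.1).im *
    (Matrix.GeneralLinearGroup.map ι₂ g • z.2).im
  rw [UpperHalfPlane.im_smul_eq_div_normSq, UpperHalfPlane.im_smul_eq_div_normSq, hg, det_map_zsqrtdGL, det_map_zsqrtdGL, ← hg, hMdet]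
  simp only [map_intCast, abs_of_pos hnR]
  have p1 := UpperHalfPlane.normSq_denom_pos (Matrix.GeneralLinearGroup.map ι₁ g) z.1.im_ne_zero
  have p2 := UpperHalfPlane.normSq_denom_pos (Matrix.GeneralLinearGroup.map ι₂ g) z.2.im_ne_zero
  set N₁ := Complex.normSq (UpperHalfPlane.denom (Matrix.GeneralLinearGroup.map ι₁ g) z.1)
  set N₂ := Complex.normSq (UpperHalfPlane.denom (Matrix.GeneralLinearGroup.map ι₂ g) z.2)
  set t₁ := Complex.normSq ((ι₁ (zsqrtdHom hsqrt c) : ℂ) * z.1 + ι₁ (zsqrtdHom hsqrt d))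
  set t₂ := Complex.normSq ((ι₂ (zsqrtdHom hsqrt c) : ℂ) * z.2 + ι₂ (zsqrtdHom hsqrt d))
  have hy1 := z.1.im_pos
  have hy2 := z.2.im_pos
  have ht2 : 0 ≤ t₂ := Complex.normSq_nonneg _
  have hNN : N₁ * N₂ ≤ n ^ 4 * (B ^ 2 * (z.1.im * z.2.im)) := by
    calc N₁ * N₂ ≤ ((ι₁ (zsqrtdHom hsqrt β) ^ 2) * (ι₂ (zsqrtdHom hsqrt β) ^ 2)) * (N₁ * N₂) :=
          le_mul_of_one_le_left (by positivity) hN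
      _ = (ι₁ (zsqrtdHom hsqrt β) ^ 2 * N₁) * (ι₂ (zsqrtdHom hsqrt β) ^ 2 * N₂) := by ring
      _ = n ^ 4 * (t₁ * t₂) := by rw [k1, k2]; ring
      _ ≤ n ^ 4 * ((B * z.1.im) * (B * z.2.im)) := by gcongr
      _ = _ := by ring
  rw [div_mul_div_comm, div_le_div_iff₀ (by positivity) (by positivity)]
  calc 1 * (N₁ * N₂) ≤ n ^ 4 * (B ^ 2 * (z.1.im * z.2.im)) := by rwa [one_mul]
    _ = _ := by ring

/-- A fundamental unit direction: Pell's equation. -/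
theorem exists_unit_gt_one (hsqrt : sqrtD ^ 2 = (D : K)) (hD : ¬ IsSquare D) (hs : ι₁ sqrtD ≠ 0)
    (hι : ι₂ sqrtD = -ι₁ sqrtD) :
    ∃ e : (ℤ√D)ˣ, 1 < ι₁ (zsqrtdHom hsqrt e) ∧
      ι₁ (zsqrtdHom hsqrt e) * ι₂ (zsqrtdHom hsqrt e) = 1 := by
  have h := congrArg ι₁ hsqrt
  simp only [map_pow, map_intCast] at h
  have hpos : 0 < D := by
    have : (0 : ℝ) < D := by rw [← h]; positivity
    exact_mod_cast this
  obtain ⟨a, ha, hy⟩ := Pell.Solution₁.exists_pos_of_not_isSquare hpos hD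
  have hx1 : (1 : ℝ) < a.x := by exact_mod_cast ha
  have hy1 : (0 : ℝ) < a.y := by exact_mod_cast hy
  have hmk : ∀ e : ℤ√D, e.norm = 1 → 1 < ι₁ (zsqrtdHom hsqrt e) → ∃ e : (ℤ√D)ˣ,
      1 < ι₁ (zsqrtdHom hsqrt e) ∧ ι₁ (zsqrtdHom hsqrt e) * ι₂ (zsqrtdHom hsqrt e) = 1 := by
    intro e he he1
    have hu : IsUnit e := (Zsqrtd.isUnit_iff_norm_isUnit e).2 (by rw [he]; exact isUnit_one)
    obtain ⟨u, rfl⟩ := hu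
    exact ⟨u, he1, by rw [embedding_mul_embedding hsqrt hι, he]; simp⟩
  have hprop := a.prop
  -- The sign of `ι₁ √D` decides which of the two conjugate Pell units exceeds 1.
  rcases hs.lt_or_gt with hneg | hpos'
  · refine hmk ⟨a.x, -a.y⟩ (by rw [Zsqrtd.norm_def]; linarith) ?_
    simp only [zsqrtdHom_apply, map_add, map_mul, map_intCast]
    push_cast
    nlinarith
  · refine hmk ⟨a.x, a.y⟩ (by rw [Zsqrtd.norm_def]; linarith) ?_
    simp only [zsqrtdHom_apply, map_add, map_mul, map_intCast]
    nlinarith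

/-- `ℤ[√D]` is a lattice in `ℝ²`: write `x₁ = p + q s`, `x₂ = p - q s` and round `p` and `q`. -/
theorem exists_translation (hsqrt : sqrtD ^ 2 = (D : K)) (hs : ι₁ sqrtD ≠ 0)
    (hι : ι₂ sqrtD = -ι₁ sqrtD) (x₁ x₂ : ℝ) : ∃ t : ℤ√D,
      |x₁ + ι₁ (zsqrtdHom hsqrt t)| ≤ 1 + |ι₁ sqrtD| ∧
      |x₂ + ι₂ (zsqrtdHom hsqrt t)| ≤ 1 + |ι₁ sqrtD| := by
  set s := ι₁ sqrtD
  let p := (x₁ + x₂) / 2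
  let q := (x₁ - x₂) / (2 * s)
  have hp := abs_sub_round p
  have hq := abs_sub_round q
  have e1 : x₁ = p + q * s := by simp only [p, q]; field_simp; ring
  have e2 : x₂ = p - q * s := by simp only [p, q]; field_simp; ring
  have hqs : |(q - round q) * s| ≤ |s| := by
    rw [abs_mul]
    exact mul_le_of_le_one_left (abs_nonneg _) (by linarith)
  refine ⟨⟨-round p, -round q⟩, ?_, ?_⟩
  · simp only [zsqrtdHom_apply, map_add, map_mul, map_intCast]
    have : x₁ + (((-round p : ℤ) : ℝ) + ((-round q : ℤ) : ℝ) * s) = (p - round p) + (q - round q) * s := by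
      rw [e1]; push_cast; ring
    rw [this]
    exact (abs_add_le _ _).trans (by linarith)
  · simp only [zsqrtdHom_apply, map_add, map_mul, map_intCast, hι]
    have : x₂ + (((-round p : ℤ) : ℝ) + ((-round q : ℤ) : ℝ) * -s) = (p - round p) - (q - round q) * s := by
      rw [e2]; push_cast; ring
    rw [this]
    exact (abs_sub _ _).trans (by linarith)

end Reduction

end HilbertModular

namespace HilbertModular

open MeasureTheory Set Topology Pointwise

/-! ### Covering by finitely many translates of half strips. -/

section Covering

variable {K : Type*} [Field K] {ι₁ ι₂ : K →+* ℝ} {sqrtD : K} {D : ℤ}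

theorem smul_re_im_of_upper {g : GL (Fin 2) ℝ} (h10 : g 1 0 = 0) (hdet : 0 < g.det.val) (z : ℍ) :
    (g • z).re = (g 0 0 / g 1 1) * z.re + g 0 1 / g 1 1 ∧ (g • z).im = (g 0 0 / g 1 1) * z.im := by
  have h := UpperHalfPlane.coe_smul_of_det_pos hdet z
  have e : (((g • z : ℍ)) : ℂ) = ((g 0 0 / g 1 1 : ℝ) : ℂ) * z + ((g 0 1 / g 1 1 : ℝ) : ℂ) := by
    rw [h, UpperHalfPlane.num, UpperHalfPlane.denom, h10]
    push_cast
    ring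
  have hre := congrArg Complex.re e
  have him := congrArg Complex.im e
  simp only [Complex.add_re, Complex.mul_re, Complex.ofReal_re, Complex.ofReal_im, zero_mul, sub_zero,
    Complex.add_im, Complex.mul_im, add_zero, UpperHalfPlane.coe_re, UpperHalfPlane.coe_im] at hre him
  exact ⟨hre, him⟩

/-- Points far away from the boundary can be moved into a product of half strips by
upper triangular matrices. -/
theorem exists_smul_mem_halfStrip [CharZero K] (hsqrt : sqrtD ^ 2 = (D : K)) (hD : ¬ IsSquare D)
    (hs : ι₁ sqrtD ≠ 0) (hι : ι₂ sqrtD = -ι₁ sqrtD) {κ : ℝ} (hκ : 0 < κ) :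
    ∃ C η : ℝ, 0 < η ∧ ∀ z : ℍ × ℍ, κ ≤ z.1.im * z.2.im → ∃ M : Matrix (Fin 2) (Fin 2) (ℤ√D),
      M.det = 1 ∧ ∃ h, glActionHom ι₁ ι₂ (zsqrtdGL hsqrt M h) z ∈ halfStrip C η ×ˢ halfStrip C η := by
  obtain ⟨e, he1, he⟩ := exists_unit_gt_one hsqrt hD hs hι
  set l := ι₁ (zsqrtdHom hsqrt e) with hl
  have hl0 : 0 < l := by linarith
  have hl2 : ι₂ (zsqrtdHom hsqrt e) = l⁻¹ := eq_inv_of_mul_eq_one_right he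
  have hl4 : 1 < l ^ 4 := one_lt_pow₀ he1 (by norm_num)
  -- If `Y₁ Y₂ ≥ κ` and `1 ≤ Y₁/Y₂ ≤ l⁴`, then both `Y₁` and `Y₂` are at least `√(κ/l⁴)`.
  refine ⟨1 + |ι₁ sqrtD|, √(κ / l ^ 4), Real.sqrt_pos.2 (by positivity), fun z hz => ?_⟩
  have hy1 := z.1.im_pos
  have hy2 := z.2.im_pos
  obtain ⟨k, hk1, hk2⟩ := exists_mem_Ico_zpow (div_pos hy1 hy2) hl4
  -- The matrix `diag(u, u⁻¹)` multiplies `y₁/y₂` by `a⁴ = l^(-4k)`, which brings the ratio into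
  -- `[1, l⁴)`.
  let u : (ℤ√D)ˣ := e ^ (-k)
  have hιu : ∀ ι : K →+* ℝ, ι (zsqrtdHom hsqrt (u : ℤ√D)) = ι (zsqrtdHom hsqrt e) ^ (-k) := by
    intro ι
    have := map_zpow (Units.map ((ι.comp (zsqrtdHom hsqrt) : ℤ√D →+* ℝ) : ℤ√D →* ℝ)) e (-k)
    have := congrArg Units.val this
    rw [Units.val_zpow_eq_zpow_val] at this
    exact this
  have hu1 := hιu ι₁
  have hu2 := hιu ι₂
  rw [← hl] at hu1
  rw [hl2] at hu2
  set a := ι₁ (zsqrtdHom hsqrt (u : ℤ√D)) with ha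
  have ha0 : 0 < a := by rw [hu1]; positivity
  have hb : ι₂ (zsqrtdHom hsqrt (u : ℤ√D)) = a⁻¹ := by rw [hu2, hu1, inv_zpow]
  have hinv : ∀ ι : K →+* ℝ, ι (zsqrtdHom hsqrt ((u⁻¹ : (ℤ√D)ˣ) : ℤ√D)) =
      (ι (zsqrtdHom hsqrt (u : ℤ√D)))⁻¹ := by
    intro ι
    apply eq_inv_of_mul_eq_one_right
    rw [← map_mul, ← map_mul, Units.mul_inv, map_one, map_one]
  obtain ⟨t, ht1, ht2⟩ := exists_translation hsqrt hs hι (a ^ 2 * z.1.re) ((a⁻¹) ^ 2 * z.2.re)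
  -- This matrix acts by `z ↦ u² z + t`.
  have hdet : (!![(u : ℤ√D), t * (u⁻¹ : (ℤ√D)ˣ); 0, (u⁻¹ : (ℤ√D)ˣ)]).det = 1 := by
    rw [Matrix.det_fin_two_of]; simp
  have h0 : zsqrtdHom hsqrt (!![(u : ℤ√D), t * (u⁻¹ : (ℤ√D)ˣ); 0, (u⁻¹ : (ℤ√D)ˣ)]).det ≠ 0 := by
    rw [hdet, map_one]; exact one_ne_zero
  refine ⟨_, hdet, h0, ?_⟩
  set g := zsqrtdGL hsqrt _ h0 with hg
  have hgdet : ∀ ι : K →+* ℝ, 0 < (Matrix.GeneralLinearGroup.map ι g).det.val := by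
    intro ι
    rw [hg, det_map_zsqrtdGL, hdet, map_one, map_one]; exact one_pos
  have hform : ∀ (ι : K →+* ℝ) (w : ℍ),
      (Matrix.GeneralLinearGroup.map ι g • w).re = ι (zsqrtdHom hsqrt (u : ℤ√D)) ^ 2 * w.re +
        ι (zsqrtdHom hsqrt t) ∧
      (Matrix.GeneralLinearGroup.map ι g • w).im = ι (zsqrtdHom hsqrt (u : ℤ√D)) ^ 2 * w.im := by
    intro ι w
    have h00 : Matrix.GeneralLinearGroup.map ι g 0 0 = ι (zsqrtdHom hsqrt (u : ℤ√D)) := rfl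
    have h01 : Matrix.GeneralLinearGroup.map ι g 0 1 =
      ι (zsqrtdHom hsqrt (t * (u⁻¹ : (ℤ√D)ˣ))) := rfl
    have h10 : Matrix.GeneralLinearGroup.map ι g 1 0 = ι (zsqrtdHom hsqrt 0) := rfl
    have h11 : Matrix.GeneralLinearGroup.map ι g 1 1 =
      ι (zsqrtdHom hsqrt ((u⁻¹ : (ℤ√D)ˣ) : ℤ√D)) := rfl
    have hne : ι (zsqrtdHom hsqrt (u : ℤ√D)) ≠ 0 := ((u.isUnit.map (zsqrtdHom hsqrt)).map ι).ne_zero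
    have := smul_re_im_of_upper (g := Matrix.GeneralLinearGroup.map ι g) (by rw [h10]; simp)
      (hgdet ι) w
    rw [h00, h01, h11, map_mul, map_mul, hinv] at this
    rw [this.1, this.2]
    constructor <;> field_simp
  obtain ⟨r1, i1⟩ := hform ι₁ z.1
  obtain ⟨r2, i2⟩ := hform ι₂ z.2
  rw [← ha] at r1 i1
  rw [hb] at r2 i2
  have hprod : κ ≤ (a ^ 2 * z.1.im) * ((a⁻¹) ^ 2 * z.2.im) := by
    refine hz.trans (le_of_eq ?_)
    field_simp
  have ha4 : a ^ 4 = (l ^ 4) ^ (-k) := by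
    rw [hu1, ← zpow_natCast, ← zpow_natCast, ← zpow_mul, ← zpow_mul, mul_comm]
  have hlk : (0 : ℝ) < (l ^ 4) ^ k := by positivity
  have hratio1 : (a⁻¹) ^ 2 * z.2.im ≤ a ^ 2 * z.1.im := by
    have : 1 ≤ a ^ 4 * (z.1.im / z.2.im) := by
      rw [ha4, zpow_neg, inv_mul_eq_div, one_le_div hlk]; exact hk1
    rw [← mul_div_assoc, one_le_div hy2] at this
    rw [inv_pow, inv_mul_le_iff₀ (by positivity)]
    calc z.2.im ≤ a ^ 4 * z.1.im := this
      _ = _ := by ring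
  have hratio2 : a ^ 2 * z.1.im ≤ l ^ 4 * ((a⁻¹) ^ 2 * z.2.im) := by
    have : a ^ 4 * (z.1.im / z.2.im) ≤ l ^ 4 := by
      rw [ha4, zpow_neg, inv_mul_eq_div, div_le_iff₀ hlk, mul_comm, ← zpow_add_one₀ (by positivity)]
      exact hk2.le
    rw [← mul_div_assoc, div_le_iff₀ hy2] at this
    have h2 : a ^ 2 * (a ^ 2 * z.1.im) ≤ a ^ 2 * (l ^ 4 * ((a⁻¹) ^ 2 * z.2.im)) := by
      calc a ^ 2 * (a ^ 2 * z.1.im) = a ^ 4 * z.1.im := by ring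
        _ ≤ l ^ 4 * z.2.im := this
        _ = _ := by field_simp
    exact le_of_mul_le_mul_left h2 (by positivity)
  set Y₁ := a ^ 2 * z.1.im
  set Y₂ := (a⁻¹) ^ 2 * z.2.im
  have hY1 : 0 < Y₁ := by positivity
  have hY2 : 0 < Y₂ := by positivity
  refine ⟨⟨?_, ?_⟩, ⟨?_, ?_⟩⟩
  · change |(Matrix.GeneralLinearGroup.map ι₁ g • z.1).re| ≤ _
    rw [r1]; exact ht1
  · change _ ≤ (Matrix.GeneralLinearGroup.map ι₁ g • z.1).im
    rw [i1]
    refine Real.sqrt_le_iff.2 ⟨hY1.le, ?_⟩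
    calc κ / l ^ 4 ≤ κ := div_le_self hκ.le hl4.le
      _ ≤ Y₁ * Y₂ := hprod
      _ ≤ Y₁ ^ 2 := by rw [sq]; gcongr
  · change |(Matrix.GeneralLinearGroup.map ι₂ g • z.2).re| ≤ _
    rw [r2]; exact ht2
  · change _ ≤ (Matrix.GeneralLinearGroup.map ι₂ g • z.2).im
    rw [i2]
    refine Real.sqrt_le_iff.2 ⟨hY2.le, ?_⟩
    rw [div_le_iff₀ (by positivity)]
    calc κ ≤ Y₁ * Y₂ := hprod
      _ ≤ (l ^ 4 * Y₂) * Y₂ := by gcongr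
      _ = _ := by ring

/-- Reduction theory: finitely many translates (modulo congruence subgroups) of a product of half
strips cover `ℍ × ℍ`. -/
theorem exists_det_eq_smul_mem_halfStrip [CharZero K] (hsqrt : sqrtD ^ 2 = (D : K))
    (hD : ¬ IsSquare D) (hs : ι₁ sqrtD ≠ 0) (hι : ι₂ sqrtD = -ι₁ sqrtD) :
    ∃ n : ℤ, 0 < n ∧ ∃ C η : ℝ, 0 < η ∧ ∀ z : ℍ × ℍ, ∃ M : Matrix (Fin 2) (Fin 2) (ℤ√D),
      M.det = n ∧ ∃ h, glActionHom ι₁ ι₂ (zsqrtdGL hsqrt M h) z ∈ halfStrip C η ×ˢ halfStrip C η := by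
  obtain ⟨n, hn, κ, hκ, h1⟩ := exists_le_im_mul_im (ι₂ := ι₂) hsqrt (fun n hn => hD ⟨n, hn⟩) hs hι
  obtain ⟨C, η, hη, h2⟩ := exists_smul_mem_halfStrip (ι₂ := ι₂) hsqrt hD hs hι hκ
  refine ⟨n, hn, C, η, hη, fun z => ?_⟩
  obtain ⟨M, hM, h, hz⟩ := h1 z
  obtain ⟨M', hM', h', hz'⟩ := h2 _ hz
  have hdet : (M' * M).det = n := by rw [Matrix.det_mul, hM, hM', one_mul]
  refine ⟨M' * M, hdet, zsqrtdHom_intCast_ne_zero hsqrt hn hdet, ?_⟩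
  rw [zsqrtdGL_mul hsqrt M' M h' h, map_mul]
  exact hz'

/-- `Γ` contains a principal congruence subgroup of `SL₂(ℤ[√D])`. -/
def ContainsCongruenceSubgroup (sqrtD : K) (Γ : Subgroup SL(2, K)) : Prop :=
  ∃ N : ℤ, 0 < N ∧ ∀ g : SL(2, K), (∀ i j, ∃ u v : ℤ,
    g i j = (1 : Matrix (Fin 2) (Fin 2) K) i j + N * (u + v * sqrtD)) → g ∈ Γ

/-- Matrices over `ℤ[√D]` of determinant `n` which are congruent modulo `n N` differ by an element
of the congruence subgroup of level `N`. -/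
theorem exists_mul_eq_of_congr (hD : ∀ n : ℤ, D ≠ n * n) {n N : ℤ} (hn : 0 < n)
    {M M' E : Matrix (Fin 2) (Fin 2) (ℤ√D)} (hM : M.det = n) (hM' : M'.det = n)
    (hE : M = M' + (n : ℤ√D) • (N : ℤ√D) • E) :
    ∃ F : Matrix (Fin 2) (Fin 2) (ℤ√D), (1 + (N : ℤ√D) • F).det = 1 ∧ M' * (1 + (N : ℤ√D) • F) = M := by
  have := isDomain_zsqrtd hD
  have hn0 : (n : ℤ√D) ≠ 0 := by exact_mod_cast hn.ne'
  -- From `M' * adj M' = n` one gets `n N E = M' * (N adj M' * E)`.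
  have hmul : M' * (1 + (N : ℤ√D) • (M'.adjugate * E)) = M := by
    rw [mul_add, mul_one, Matrix.mul_smul, ← mul_assoc, Matrix.mul_adjugate, hM', Matrix.smul_mul,
      one_mul, smul_comm, hE]
  refine ⟨M'.adjugate * E, mul_left_cancel₀ hn0 ?_, hmul⟩
  rw [mul_one, ← hM', ← Matrix.det_mul, hmul, hM, hM']

/-- A group containing a congruence subgroup has a set of finite volume meeting all orbits. -/
theorem exists_covering_measure_lt_top [CharZero K] (hsqrt : sqrtD ^ 2 = (D : K))
    (hD : ¬ IsSquare D) (hs : ι₁ sqrtD ≠ 0) (hι : ι₂ sqrtD = -ι₁ sqrtD) {Γ : Subgroup SL(2, K)}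
    (hΓ : ContainsCongruenceSubgroup sqrtD Γ) :
    ∃ S : Set (ℍ × ℍ), gaussBonnetMeasure S < ⊤ ∧
      ∀ z, ∃ γ : Γ.map (actionHom ι₁ ι₂), γ • z ∈ S := by
  classical
  obtain ⟨N, hN, hNΓ⟩ := hΓ
  obtain ⟨n, hn, C, η, hη, hcov⟩ := exists_det_eq_smul_mem_halfStrip (ι₂ := ι₂) hsqrt hD hs hι
  let m : ℕ := (n * N).natAbs
  have hm : (m : ℤ) = n * N := Int.natAbs_of_nonneg (by positivity)
  have hm0 : m ≠ 0 := by have : 0 < n * N := by positivity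
                         omega
  have : NeZero m := ⟨hm0⟩
  -- Residues modulo `n N` split the matrices of determinant `n` into finitely many classes, and one
  -- representative per class suffices.
  let ρ : Matrix (Fin 2) (Fin 2) (ℤ√D) → Fin 2 → Fin 2 → ZMod m × ZMod m :=
    fun M i j => ((M i j).re, (M i j).im)
  let T : Set (ℍ × ℍ) := halfStrip C η ×ˢ halfStrip C η
  let P : (Fin 2 → Fin 2 → ZMod m × ZMod m) → Set (ℍ × ℍ) := fun r =>
    if h : ∃ M : Matrix (Fin 2) (Fin 2) (ℤ√D), M.det = n ∧ ρ M = r then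
      glActionHom ι₁ ι₂ (zsqrtdGL hsqrt h.choose
        (zsqrtdHom_intCast_ne_zero hsqrt hn h.choose_spec.1)) ⁻¹' T
    else ∅
  refine ⟨⋃ r, P r, ?_, fun z => ?_⟩
  · refine (measure_iUnion_le _).trans_lt ?_
    rw [tsum_fintype]
    refine ENNReal.sum_lt_top.2 fun r _ => ?_
    simp only [P]
    split_ifs with h
    · rw [(measurePreserving_glActionHom ι₁ ι₂ _).measure_preimage
        ((measurableSet_halfStrip C η).prod (measurableSet_halfStrip C η)).nullMeasurableSet]
      exact gaussBonnetMeasure_halfStrip_lt_top C hη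
    · simp
  · obtain ⟨M, hM, h0, hz⟩ := hcov z
    have hex : ∃ M' : Matrix (Fin 2) (Fin 2) (ℤ√D), M'.det = n ∧ ρ M' = ρ M := ⟨M, hM, rfl⟩
    have hM'det := hex.choose_spec.1
    have hM'ρ := hex.choose_spec.2
    have hP : P (ρ M) = glActionHom ι₁ ι₂ (zsqrtdGL hsqrt hex.choose
        (zsqrtdHom_intCast_ne_zero hsqrt hn hex.choose_spec.1)) ⁻¹' T := dif_pos hex
    have h0' := zsqrtdHom_intCast_ne_zero hsqrt hn hex.choose_spec.1
    set M' := hex.choose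
    have hdiv : ∀ i j, ∃ x : ℤ√D, M i j = M' i j + n * (N * x) := by
      intro i j
      have e := congrFun (congrFun hM'ρ i) j
      have e1 := (ZMod.intCast_eq_intCast_iff_dvd_sub _ _ _).1 (congrArg Prod.fst e)
      have e2 := (ZMod.intCast_eq_intCast_iff_dvd_sub _ _ _).1 (congrArg Prod.snd e)
      rw [hm] at e1 e2
      obtain ⟨u, hu⟩ := e1
      obtain ⟨v, hv⟩ := e2
      refine ⟨⟨u, v⟩, ?_⟩
      rw [Zsqrtd.ext_iff]
      simp
      constructor <;> linarith
    choose E hE using hdiv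
    obtain ⟨F, hF1, hF2⟩ := exists_mul_eq_of_congr (fun n hn => hD ⟨n, hn⟩) hn hM hM'det
      (E := Matrix.of E) (N := N) (by ext1 i j; simpa using hE i j)
    have hG0 : zsqrtdHom hsqrt (1 + (N : ℤ√D) • F).det ≠ 0 := by rw [hF1, map_one]; exact one_ne_zero
    let γ : SL(2, K) := Matrix.SpecialLinearGroup.map (zsqrtdHom hsqrt) ⟨1 + (N : ℤ√D) • F, hF1⟩
    have hγ : γ ∈ Γ := by
      refine hNΓ γ fun i j => ⟨(F i j).re, (F i j).im, ?_⟩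
      change zsqrtdHom hsqrt ((1 + (N : ℤ√D) • F) i j) = _
      rw [← zsqrtdHom_apply hsqrt, Matrix.add_apply, map_add, Matrix.smul_apply, smul_eq_mul, map_mul,
        map_intCast, Matrix.one_apply, Matrix.one_apply, apply_ite (zsqrtdHom hsqrt), map_one, map_zero]
    have hγGL : zsqrtdGL hsqrt _ hG0 = (γ : GL (Fin 2) K) := Units.ext rfl
    refine ⟨⟨_, γ, hγ, rfl⟩, mem_iUnion.2 ⟨ρ M, ?_⟩⟩
    -- Since `M' γ = M`, the representative `M'` sends `γ z` to `M z`, which lies in the strips.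
    rw [hP]
    change glActionHom ι₁ ι₂ (zsqrtdGL hsqrt M' h0') (actionHom ι₁ ι₂ γ z) ∈ T
    rw [← glActionHom_coe, ← hγGL, ← Equiv.Perm.mul_apply, ← map_mul,
      ← zsqrtdGL_mul hsqrt _ _ h0' hG0 (by rw [hF2]; exact h0)]
    simp only [hF2]
    exact hz

end Covering

end HilbertModular

namespace HilbertModular

/-! ### Reduction to `SL₂(𝔽₂)`. -/

section IndexThree

/-- The lower triangular matrices over `ℤ / 2`. -/
def lowerTriangularModTwo : Subgroup SL(2, ZMod 2) where
  carrier := {g | g 0 1 = 0}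
  one_mem' := by decide
  mul_mem' := by
    intro g h (hg : g 0 1 = 0) (hh : h 0 1 = 0)
    change (g * h) 0 1 = 0
    rw [Matrix.SpecialLinearGroup.coe_mul, Matrix.mul_apply]
    simp [Fin.sum_univ_two, hg, hh]
  inv_mem' := by
    intro g (hg : g 0 1 = 0)
    change g⁻¹ 0 1 = 0
    simp [Matrix.adjugate_fin_two, hg]

/-- The upper triangular matrices over `ℤ / 2`. -/
def upperTriangularModTwo : Subgroup SL(2, ZMod 2) where
  carrier := {g | g 1 0 = 0}
  one_mem' := by decide
  mul_mem' := by
    intro g h (hg : g 1 0 = 0) (hh : h 1 0 = 0)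
    change (g * h) 1 0 = 0
    rw [Matrix.SpecialLinearGroup.coe_mul, Matrix.mul_apply]
    simp [Fin.sum_univ_two, hg, hh]
  inv_mem' := by
    intro g (hg : g 1 0 = 0)
    change g⁻¹ 1 0 = 0
    simp [Matrix.adjugate_fin_two, hg]

theorem card_SL_two_zmod_two : Nat.card SL(2, ZMod 2) = 6 := by
  rw [Nat.card_eq_fintype_card]
  decide +kernel

theorem index_lowerTriangularModTwo : lowerTriangularModTwo.index = 3 := by
  have h := lowerTriangularModTwo.index_mul_card
  have h2 : Nat.card lowerTriangularModTwo = 2 := by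
    have : Nat.card {g : SL(2, ZMod 2) // g 0 1 = 0} = 2 := by
      rw [Nat.card_eq_fintype_card]
      decide +kernel
    exact this
  rw [h2, card_SL_two_zmod_two] at h
  omega

theorem index_upperTriangularModTwo : upperTriangularModTwo.index = 3 := by
  have h := upperTriangularModTwo.index_mul_card
  have h2 : Nat.card upperTriangularModTwo = 2 := by
    have : Nat.card {g : SL(2, ZMod 2) // g 1 0 = 0} = 2 := by
      rw [Nat.card_eq_fintype_card]
      decide +kernel
    exact this
  rw [h2, card_SL_two_zmod_two] at h
  omega

/-- This reduces surjectivity onto `SL₂(𝔽₂)` to hitting two elementary matrices. -/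
theorem SL_two_zmod_two_eq (g : SL(2, ZMod 2)) (U L : SL(2, ZMod 2)) (hU : U.1 = !![1, 1; 0, 1])
    (hL : L.1 = !![1, 0; 1, 1]) :
    g = 1 ∨ g = U ∨ g = L ∨ g = U * L ∨ g = L * U ∨ g = U * L * U := by
  have key : ∀ M : Matrix (Fin 2) (Fin 2) (ZMod 2), M.det = 1 →
      M = 1 ∨ M = !![1, 1; 0, 1] ∨ M = !![1, 0; 1, 1] ∨ M = !![1, 1; 0, 1] * !![1, 0; 1, 1] ∨
      M = !![1, 0; 1, 1] * !![1, 1; 0, 1] ∨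
      M = !![1, 1; 0, 1] * !![1, 0; 1, 1] * !![1, 1; 0, 1] := by decide +kernel
  have h := key g.1 g.2
  rw [← hU, ← hL, ← Matrix.SpecialLinearGroup.coe_one, ← Matrix.SpecialLinearGroup.coe_mul,
    ← Matrix.SpecialLinearGroup.coe_mul, ← Matrix.SpecialLinearGroup.coe_mul] at h
  exact h.imp Subtype.ext (Or.imp Subtype.ext (Or.imp Subtype.ext (Or.imp Subtype.ext
    (Or.imp Subtype.ext Subtype.ext))))

variable {K : Type*} [Field K]

/-- Reduction of a group of matrices modulo an ideal of norm two. -/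
theorem exists_reduction_mod_two {O : Subalgebra ℤ K} (π : O →+* ZMod 2) {Γ : Subgroup SL(2, K)}
    {β γ : K} (ha : ∀ g ∈ Γ, g 0 0 ∈ O) (hd : ∀ g ∈ Γ, g 1 1 ∈ O) (hb : ∀ g ∈ Γ, g 0 1 * γ ∈ O)
    (hc : ∀ g ∈ Γ, g 1 0 * β ∈ O) (hbc : ∀ g ∈ Γ, ∀ h ∈ Γ, g 0 1 * h 1 0 ∈ O) (hβγ : β * γ ∈ O)
    (hπ : π ⟨β * γ, hβγ⟩ = 1) (hU : ⟨!![1, β; 0, 1], by simp⟩ ∈ Γ)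
    (hL : ⟨!![1, 0; γ, 1], by simp⟩ ∈ Γ) :
    ∃ φ : Γ →* SL(2, ZMod 2), Function.Surjective φ ∧
      ∀ g : Γ, φ g 0 1 = π ⟨_, hb g g.2⟩ ∧ φ g 1 0 = π ⟨_, hc g g.2⟩ := by
  let A : Γ → ZMod 2 := fun g => π ⟨_, ha g g.2⟩
  let B : Γ → ZMod 2 := fun g => π ⟨_, hb g g.2⟩
  let C : Γ → ZMod 2 := fun g => π ⟨_, hc g g.2⟩
  let E : Γ → ZMod 2 := fun g => π ⟨_, hd g g.2⟩
  -- The off-diagonal entries are rescaled by `γ` and `β`. Since `π (β γ) = 1`, the product of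
  -- rescaled entries has the residue of the original product, which makes the reduction
  -- multiplicative even if `β γ ≠ 1`.
  have hBC : ∀ g h : Γ, B g * C h = π ⟨_, hbc g g.2 h h.2⟩ := by
    intro g h
    rw [← one_mul (π ⟨_, hbc g g.2 h h.2⟩), ← hπ, ← map_mul, ← map_mul]
    congr 1
    apply Subtype.ext
    simp only [MulMemClass.mk_mul_mk]
    ring
  have hdet : ∀ g : Γ, (!![A g, B g; C g, E g]).det = 1 := by
    intro g
    rw [Matrix.det_fin_two_of, hBC, ← map_mul, ← map_sub, ← map_one π]
    congr 1
    apply Subtype.ext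
    have := g.1.det_coe
    rw [Matrix.det_fin_two] at this
    exact this
  have e : ∀ (g h : Γ) i j, (g * h).1 i j = g.1 i 0 * h.1 0 j + g.1 i 1 * h.1 1 j := by
    intro g h i j
    rw [Subgroup.coe_mul, Matrix.SpecialLinearGroup.coe_mul, Matrix.mul_apply, Fin.sum_univ_two]
  have hA : ∀ g h, A (g * h) = A g * A h + B g * C h := by
    intro g h
    rw [hBC, ← map_mul, ← map_add]
    exact congrArg π (Subtype.ext (e g h 0 0))
  have hB : ∀ g h, B (g * h) = A g * B h + B g * E h := by
    intro g h
    rw [← map_mul, ← map_mul, ← map_add]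
    exact congrArg π (Subtype.ext ((congrArg (· * γ) (e g h 0 1)).trans (by simp; ring)))
  have hC : ∀ g h, C (g * h) = C g * A h + E g * C h := by
    intro g h
    rw [← map_mul, ← map_mul, ← map_add]
    exact congrArg π (Subtype.ext ((congrArg (· * β) (e g h 1 0)).trans (by simp; ring)))
  have hE : ∀ g h, E (g * h) = C g * B h + E g * E h := by
    intro g h
    rw [mul_comm (C g), hBC, ← map_mul, ← map_add]
    exact congrArg π (Subtype.ext ((e g h 1 1).trans (by simp; ring)))
  let φ : Γ →* SL(2, ZMod 2) := MonoidHom.mk' (fun g => ⟨!![A g, B g; C g, E g], hdet g⟩) (by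
    intro g h
    apply Subtype.ext
    change !![A (g * h), B (g * h); C (g * h), E (g * h)] =
      !![A g, B g; C g, E g] * !![A h, B h; C h, E h]
    rw [Matrix.mul_fin_two, hA, hB, hC, hE])
  refine ⟨φ, fun x => ?_, fun g => ⟨rfl, rfl⟩⟩
  let U : Γ := ⟨_, hU⟩
  let L : Γ := ⟨_, hL⟩
  have h1 : ∀ (x : K) (hx : x ∈ O), x = 1 → π ⟨x, hx⟩ = 1 := by
    rintro x hx rfl
    exact map_one π
  have h0 : ∀ (x : K) (hx : x ∈ O), x = 0 → π ⟨x, hx⟩ = 0 := by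
    rintro x hx rfl
    exact map_zero π
  have hφU : (φ U).1 = !![1, 1; 0, 1] := by
    change !![A U, B U; C U, E U] = _
    have e1 : A U = 1 := h1 _ _ (by simp [U])
    have e2 : B U = 1 := by rw [← hπ]; rfl
    have e3 : C U = 0 := h0 _ _ (by simp [U])
    have e4 : E U = 1 := h1 _ _ (by simp [U])
    rw [e1, e2, e3, e4]
  have hφL : (φ L).1 = !![1, 0; 1, 1] := by
    change !![A L, B L; C L, E L] = _
    have e1 : A L = 1 := h1 _ _ (by simp [L])
    have e2 : B L = 0 := h0 _ _ (by simp [L])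
    have e3 : C L = 1 := by rw [← hπ]; exact congrArg π (Subtype.ext (mul_comm γ β))
    have e4 : E L = 1 := h1 _ _ (by simp [L])
    rw [e1, e2, e3, e4]
  rcases SL_two_zmod_two_eq x _ _ hφU hφL with h | h | h | h | h | h
  · exact ⟨1, by rw [h, map_one]⟩
  · exact ⟨U, h.symm⟩
  · exact ⟨L, h.symm⟩
  · exact ⟨U * L, by rw [h, map_mul]⟩
  · exact ⟨L * U, by rw [h, map_mul]⟩
  · exact ⟨U * L * U, by rw [h, map_mul, map_mul]⟩

theorem relIndex_eq_three_of_lower {Γ H : Subgroup SL(2, K)} (φ : Γ →* SL(2, ZMod 2))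
    (hφ : Function.Surjective φ) (hH : ∀ g : Γ, g.1 ∈ H ↔ φ g 0 1 = 0) : H.relIndex Γ = 3 := by
  have : H.subgroupOf Γ = lowerTriangularModTwo.comap φ := Subgroup.ext hH
  rw [Subgroup.relIndex, this, Subgroup.index_comap_of_surjective _ hφ, index_lowerTriangularModTwo]

theorem relIndex_eq_three_of_upper {Γ H : Subgroup SL(2, K)} (φ : Γ →* SL(2, ZMod 2))
    (hφ : Function.Surjective φ) (hH : ∀ g : Γ, g.1 ∈ H ↔ φ g 1 0 = 0) : H.relIndex Γ = 3 := by
  have : H.subgroupOf Γ = upperTriangularModTwo.comap φ := Subgroup.ext hH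
  rw [Subgroup.relIndex, this, Subgroup.index_comap_of_surjective _ hφ, index_upperTriangularModTwo]

end IndexThree

end HilbertModular

namespace HilbertModular

/-! ### Congruences for discriminants. -/

section Discriminants

/-- As `D ≡ 0, 1 mod 4`, the norm `k = (D² - D)/4` of `(D + √D)/2` is an integer. -/
theorem IsFundamentalDiscriminant.four_dvd {D₀ : ℤ} (h : IsFundamentalDiscriminant D₀) (f : ℕ) :
    ∃ k : ℤ, ((f : ℤ) ^ 2 * D₀) ^ 2 - (f : ℤ) ^ 2 * D₀ = 4 * k := by
  have hf : (4 : ℤ) ∣ (f : ℤ) ^ 2 ∨ (4 : ℤ) ∣ (f : ℤ) ^ 2 - 1 := by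
    rcases Int.even_or_odd' (f : ℤ) with ⟨j, hj | hj⟩
    · left; exact ⟨j ^ 2, by rw [hj]; ring⟩
    · right; exact ⟨j ^ 2 + j, by rw [hj]; ring⟩
  have hD : (4 : ℤ) ∣ D₀ ∨ (4 : ℤ) ∣ D₀ - 1 := by
    rcases h with ⟨h, _⟩ | ⟨m, hm, _⟩
    · right; omega
    · left; exact ⟨m, hm⟩
  rcases hf with ⟨a, ha⟩ | ⟨a, ha⟩
  · exact ⟨(4 * a * D₀ - 1) * a * D₀, by rw [ha]; ring⟩
  · rcases hD with ⟨b, hb⟩ | ⟨b, hb⟩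
    · exact ⟨(f : ℤ) ^ 2 * b * ((f : ℤ) ^ 2 * D₀ - 1), by rw [hb]; ring⟩
    · refine ⟨(f : ℤ) ^ 2 * D₀ * (a * D₀ + b), ?_⟩
      have ha' : (f : ℤ) ^ 2 = 4 * a + 1 := by omega
      have hb' : D₀ = 4 * b + 1 := by omega
      rw [ha', hb']; ring

theorem IsFundamentalDiscriminant.odd_conductor {D₀ : ℤ} (h : IsFundamentalDiscriminant D₀) {f : ℕ}
    (hf : ¬ 2 ∣ f) : (∃ j, (f : ℤ) ^ 2 * D₀ = 2 * j + 1) ∨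
      ∃ m, (f : ℤ) ^ 2 * D₀ = 4 * m ∧ (m % 4 = 2 ∨ m % 4 = 3) := by
  have hf' : ∃ j : ℤ, (f : ℤ) ^ 2 = 4 * j + 1 := by
    obtain ⟨j, hj⟩ : ∃ j : ℤ, (f : ℤ) = 2 * j + 1 := ⟨(f : ℤ) / 2, by omega⟩
    exact ⟨j ^ 2 + j, by rw [hj]; ring⟩
  obtain ⟨j, hj⟩ := hf'
  rcases h with ⟨h, _⟩ | ⟨m, hm, hm4, _⟩
  · left
    obtain ⟨b, hb⟩ : ∃ b : ℤ, D₀ = 4 * b + 1 := ⟨D₀ / 4, by omega⟩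
    exact ⟨8 * j * b + 2 * j + 2 * b, by rw [hj, hb]; ring⟩
  · right
    refine ⟨4 * (j * m) + m, by rw [hj, hm]; ring, ?_⟩
    omega

/-- Here `D/4 = (f/2)² D₀` is again a discriminant, that of an order containing `O` with index 2. -/
theorem IsFundamentalDiscriminant.even_conductor {D₀ : ℤ} (h : IsFundamentalDiscriminant D₀) {f : ℕ}
    (hf : 2 ∣ f) : ∃ m, (f : ℤ) ^ 2 * D₀ = 4 * m ∧ (m % 4 = 0 ∨ m % 4 = 1) := by
  obtain ⟨j, rfl⟩ := hf
  refine ⟨(j : ℤ) ^ 2 * D₀, by push_cast; ring, ?_⟩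
  rcases h with ⟨h, _⟩ | ⟨m, hm, hm4, _⟩
  · obtain ⟨b, hb⟩ : ∃ b : ℤ, D₀ = 4 * b + 1 := ⟨D₀ / 4, by omega⟩
    rcases Int.even_or_odd' (j : ℤ) with ⟨i, hi | hi⟩
    · left
      have : (j : ℤ) ^ 2 * D₀ = 4 * (i ^ 2 * D₀) := by rw [hi]; ring
      omega
    · right
      have : (j : ℤ) ^ 2 * D₀ = 4 * (4 * (i ^ 2 + i) * b + (i ^ 2 + i) + b) + 1 := by
        rw [hi, hb]; ring
      omega
  · left
    have : (j : ℤ) ^ 2 * D₀ = 4 * ((j : ℤ) ^ 2 * m) := by rw [hm]; ring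
    omega

end Discriminants

/-! ### The quadratic order and its trace dual. -/

section QuadraticField

variable {K : Type*} [Field K] {D : ℤ} {sqrtD : K}

theorem sqrt_ne_zero (hsq : ¬ IsSquare D) [CharZero K] (hsqrt : sqrtD ^ 2 = (D : K)) : sqrtD ≠ 0 := by
  rintro rfl
  apply hsq
  have : (D : K) = 0 := by rw [← hsqrt]; simp
  rw [Int.cast_eq_zero.1 this]
  exact IsSquare.zero

theorem linearIndependent_one_sqrt [CharZero K] (hsq : ¬ IsSquare D) (hsqrt : sqrtD ^ 2 = (D : K)) :
    LinearIndependent ℚ ![(1 : K), sqrtD] := by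
  rw [LinearIndependent.pair_iff]
  intro p q h
  rw [Rat.smul_def, Rat.smul_def, mul_one] at h
  have hq : q = 0 := by
    by_contra hq
    apply hsq
    have h1 : q ^ 2 * (D : ℚ) = p ^ 2 := by
      have : ((q ^ 2 * (D : ℚ) : ℚ) : K) = ((p ^ 2 : ℚ) : K) := by
        push_cast
        rw [← hsqrt]
        linear_combination ((q : K) * sqrtD - p) * h
      exact_mod_cast this
    rw [← Rat.isSquare_intCast_iff]
    exact ⟨p / q, by field_simp; linarith⟩
  subst hq
  refine ⟨?_, rfl⟩
  simpa using h

/-- The basis `1, √D` of a quadratic field. -/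
noncomputable def quadraticBasis [NumberField K] (hK : Module.finrank ℚ K = 2) (hsq : ¬ IsSquare D)
    (hsqrt : sqrtD ^ 2 = (D : K)) : Module.Basis (Fin 2) ℚ K :=
  basisOfLinearIndependentOfCardEqFinrank (linearIndependent_one_sqrt hsq hsqrt) (by simp [hK])

theorem quadraticBasis_apply [NumberField K] (hK : Module.finrank ℚ K = 2) (hsq : ¬ IsSquare D)
    (hsqrt : sqrtD ^ 2 = (D : K)) :
    quadraticBasis hK hsq hsqrt 0 = 1 ∧ quadraticBasis hK hsq hsqrt 1 = sqrtD := by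
  simp [quadraticBasis]

theorem exists_eq_add_mul_sqrt [NumberField K] (hK : Module.finrank ℚ K = 2) (hsq : ¬ IsSquare D)
    (hsqrt : sqrtD ^ 2 = (D : K)) (x : K) : ∃ p q : ℚ, x = p + q * sqrtD := by
  have h := (quadraticBasis hK hsq hsqrt).sum_repr x
  rw [Fin.sum_univ_two, (quadraticBasis_apply hK hsq hsqrt).1, (quadraticBasis_apply hK hsq hsqrt).2] at h
  exact ⟨_, _, by rw [← h, Rat.smul_def, Rat.smul_def, mul_one]⟩

theorem trace_add_mul_sqrt [NumberField K] (hK : Module.finrank ℚ K = 2) (hsq : ¬ IsSquare D)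
    (hsqrt : sqrtD ^ 2 = (D : K)) (p q : ℚ) :
    Algebra.trace ℚ K (p + q * sqrtD) = 2 * p := by
  obtain ⟨h0, h1⟩ := quadraticBasis_apply hK hsq hsqrt
  set b := quadraticBasis hK hsq hsqrt
  rw [Algebra.trace_eq_matrix_trace b, Matrix.trace_fin_two, Algebra.leftMulMatrix_eq_repr_mul,
    Algebra.leftMulMatrix_eq_repr_mul, h0, h1]
  have e0 : ((p : K) + q * sqrtD) * 1 = p • b 0 + q • b 1 := by
    rw [h0, h1, Rat.smul_def, Rat.smul_def]; ring
  have e1 : ((p : K) + q * sqrtD) * sqrtD = (q * D : ℚ) • b 0 + p • b 1 := by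
    rw [h0, h1, Rat.smul_def, Rat.smul_def]; push_cast; linear_combination (q : K) * hsqrt
  rw [e0, e1]
  simp
  ring

theorem rat_coeff_unique [CharZero K] (hsq : ¬ IsSquare D) (hsqrt : sqrtD ^ 2 = (D : K)) {p q p' q' : ℚ}
    (h : (p : K) + q * sqrtD = p' + q' * sqrtD) : p = p' ∧ q = q' := by
  have hli := linearIndependent_one_sqrt hsq hsqrt
  rw [LinearIndependent.pair_iff] at hli
  have := hli (p - p') (q - q') (by
    rw [Rat.smul_def, Rat.smul_def]; push_cast; linear_combination h)
  exact ⟨sub_eq_zero.1 this.1, sub_eq_zero.1 this.2⟩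

theorem embedding_sqrt_eq_neg [NumberField K] (hK : Module.finrank ℚ K = 2) (hsq : ¬ IsSquare D)
    (hsqrt : sqrtD ^ 2 = (D : K)) {ι₁ ι₂ : K →+* ℝ} (hι : ι₁ ≠ ι₂) : ι₂ sqrtD = -ι₁ sqrtD := by
  have h1 := congrArg ι₁ hsqrt
  have h2 := congrArg ι₂ hsqrt
  simp only [map_pow, map_intCast] at h1 h2
  have h3 : ι₂ sqrtD ^ 2 = ι₁ sqrtD ^ 2 := by rw [h1, h2]
  rcases sq_eq_sq_iff_eq_or_eq_neg.1 h3 with h | h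
  · exfalso
    apply hι
    ext x
    obtain ⟨p, q, rfl⟩ := exists_eq_add_mul_sqrt hK hsq hsqrt x
    simp [h]
  · exact h

/-- With `w = (D + √D)/2` one has `w² = D w - k`, so `ℤ + ℤ w` is closed under multiplication. -/
theorem mem_quadraticOrder_iff [CharZero K] (hsqrt : sqrtD ^ 2 = (D : K)) {k : ℤ} (hk : D ^ 2 - D = 4 * k) (x : K) :
    x ∈ quadraticOrder D sqrtD ↔ ∃ u v : ℤ, x = u + v * (((D : K) + sqrtD) / 2) := by
  have hkK : (D : K) ^ 2 - D = 4 * k := by exact_mod_cast congrArg (Int.cast : ℤ → K) hk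
  constructor
  · intro hx
    refine Algebra.adjoin_induction ?_ ?_ ?_ ?_ hx
    · rintro x hx
      rw [Set.mem_singleton_iff] at hx
      exact ⟨0, 1, by rw [hx]; simp⟩
    · intro r
      exact ⟨r, 0, by simp⟩
    · rintro x y - - ⟨u, v, rfl⟩ ⟨u', v', rfl⟩
      exact ⟨u + u', v + v', by push_cast; ring⟩
    · rintro x y - - ⟨u, v, rfl⟩ ⟨u', v', rfl⟩
      refine ⟨u * u' - v * v' * k, u * v' + v * u' + v * v' * D, ?_⟩
      push_cast
      linear_combination (v : K) * v' * (hsqrt / 4 - hkK / 4)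
  · rintro ⟨u, v, rfl⟩
    have hw : ((D : K) + sqrtD) / 2 ∈ quadraticOrder D sqrtD :=
      Algebra.subset_adjoin (Set.mem_singleton _)
    exact add_mem (intCast_mem _ u) (mul_mem (intCast_mem _ v) hw)

/-- The different is generated by `2w - D = √D`. Explicitly, if `x` has traces `a` and `b` against
`1` and `w`, then `√D x = (b - a D) + a w`. -/
theorem mem_traceDual_iff [NumberField K] (hK : Module.finrank ℚ K = 2) (hsq : ¬ IsSquare D)
    (hsqrt : sqrtD ^ 2 = (D : K)) {k : ℤ} (hk : D ^ 2 - D = 4 * k) (x : K) :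
    x ∈ traceDual (quadraticOrder D sqrtD) ↔ sqrtD * x ∈ quadraticOrder D sqrtD := by
  obtain ⟨p, q, rfl⟩ := exists_eq_add_mul_sqrt hK hsq hsqrt x
  have htr : ∀ u v : ℤ, Algebra.trace ℚ K (((p : K) + q * sqrtD) * (u + v * (((D : K) + sqrtD) / 2))) =
      2 * p * u + (p + q) * D * v := by
    intro u v
    have : ((p : K) + q * sqrtD) * (u + v * (((D : K) + sqrtD) / 2)) =
        ((p * u + (p + q) * D * v / 2 : ℚ) : K) + ((q * u + (p + q * D) * v / 2 : ℚ) : K) * sqrtD := by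
      push_cast
      linear_combination (q : K) * v / 2 * hsqrt
    rw [this, trace_add_mul_sqrt hK hsq hsqrt]
    ring
  rw [traceDual, LinearMap.BilinForm.mem_dualSubmodule, mem_quadraticOrder_iff hsqrt hk]
  constructor
  · intro h
    have hm : ∀ u v : ℤ, ∃ n : ℤ, (n : ℚ) = 2 * p * u + (p + q) * D * v := by
      intro u v
      have := h (u + v * (((D : K) + sqrtD) / 2)) ((mem_quadraticOrder_iff hsqrt hk _).2 ⟨u, v, rfl⟩)
      rw [Algebra.traceForm_apply, htr] at this
      obtain ⟨n, hn⟩ := Submodule.mem_one.1 this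
      exact ⟨n, by simpa using hn⟩
    obtain ⟨a, ha⟩ := hm 1 0
    obtain ⟨b, hb⟩ := hm 0 1
    refine ⟨b - a * D, a, ?_⟩
    have ha' : (a : K) = 2 * p := by
      have : (a : ℚ) = 2 * p := by simpa using ha
      exact_mod_cast congrArg (Rat.cast : ℚ → K) this
    have hb' : (b : K) = (p + q) * D := by
      have : (b : ℚ) = (p + q) * D := by simpa using hb
      exact_mod_cast congrArg (Rat.cast : ℚ → K) this
    push_cast
    rw [ha', hb']
    linear_combination (q : K) * hsqrt
  · rintro ⟨a, b, hab⟩ y hy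
    obtain ⟨u, v, rfl⟩ := (mem_quadraticOrder_iff hsqrt hk _).1 hy
    have := rat_coeff_unique (p := q * D) (q := p) (p' := a + b * D / 2) (q' := b / 2) hsq hsqrt (by
      push_cast; linear_combination hab - (q : K) * hsqrt)
    rw [Algebra.traceForm_apply, htr]
    refine Submodule.mem_one.2 ⟨b * u + (a + b * D) * v, ?_⟩
    rw [eq_intCast]
    push_cast
    rw [this.2]
    have h1 := this.1
    linear_combination -(v : ℚ) * h1

end QuadraticField

end HilbertModular

namespace HilbertModular

/-! ### Lattice stabilizers in terms of matrix entries. -/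

section LatticeStabilizers

variable {K : Type*} [Field K] {O : Subalgebra ℤ K} {δ : K}

theorem forall_mem_of_mem_slLattice {I J : Submodule ℤ K} {g : SL(2, K)} (hg : g ∈ slLattice I J)
    {x y : K} (hx : x ∈ I) (hy : y ∈ J) :
    g 0 0 * x + g 0 1 * y ∈ I ∧ g 1 0 * x + g 1 1 * y ∈ J := by
  have h := (hg ![x, y]).2 ⟨hx, hy⟩
  simpa [Matrix.mulVec, dotProduct, Fin.sum_univ_two] using h

theorem mem_slLattice_of_forall_mem {I J : Submodule ℤ K} {g : SL(2, K)}
    (h : ∀ x ∈ I, ∀ y ∈ J, g 0 0 * x + g 0 1 * y ∈ I ∧ g 1 0 * x + g 1 1 * y ∈ J)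
    (h' : ∀ x ∈ I, ∀ y ∈ J, g 1 1 * x - g 0 1 * y ∈ I ∧ -(g 1 0 * x) + g 0 0 * y ∈ J) :
    g ∈ slLattice I J := by
  intro v
  have e : ∀ i, (g.1.mulVec v) i = g i 0 * v 0 + g i 1 * v 1 := fun i => by
    simp [Matrix.mulVec, dotProduct, Fin.sum_univ_two]
  have hd := g.det_coe
  rw [Matrix.det_fin_two] at hd
  rw [e, e]
  constructor
  · rintro ⟨h1, h2⟩
    have := h' _ h1 _ h2
    constructor
    · convert this.1 using 1
      linear_combination -(v 0) * hd
    · convert this.2 using 1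
      linear_combination -(v 1) * hd
  · rintro ⟨h1, h2⟩
    exact h _ h1 _ h2

/-- The entries of the matrices in `SL(I ⊕ δ⁻¹ O)` for an ideal `I` of `O`. -/
theorem mem_slLattice_iff {I J : Submodule ℤ K} (hδ : δ ≠ 0) (hJ : ∀ y, y ∈ J ↔ δ * y ∈ O)
    (hOI : ∀ o ∈ O, ∀ x ∈ I, o * x ∈ I) (g : SL(2, K)) :
    g ∈ slLattice I J ↔
      g 0 0 ∈ O ∧ g 1 1 ∈ O ∧ g 0 1 / δ ∈ I ∧ ∀ x ∈ I, δ * g 1 0 * x ∈ O := by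
  have hone : δ⁻¹ ∈ J := by rw [hJ, mul_inv_cancel₀ hδ]; exact O.one_mem
  constructor
  · intro hg
    have h1 := forall_mem_of_mem_slLattice hg I.zero_mem hone
    -- The lower right entry of `g⁻¹` is `g 0 0`. Testing on `J` rather than `I` is what yields
    -- membership in `O`, since the multiplier ring of `I` may be larger.
    have h2 := forall_mem_of_mem_slLattice (inv_mem hg) I.zero_mem hone
    simp only [mul_zero, zero_add, hJ, Matrix.SpecialLinearGroup.coe_inv, Matrix.adjugate_fin_two] at h1 h2
    refine ⟨?_, ?_, ?_, fun x hx => ?_⟩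
    · have := h2.2
      simp only [Matrix.of_apply, Matrix.cons_val_one, Matrix.cons_val_zero] at this
      rwa [mul_comm, mul_assoc, inv_mul_cancel₀ hδ, mul_one] at this
    · have := h1.2
      rwa [mul_comm, mul_assoc, inv_mul_cancel₀ hδ, mul_one] at this
    · rw [div_eq_mul_inv]; exact h1.1
    · have := (forall_mem_of_mem_slLattice hg hx J.zero_mem).2
      rw [mul_zero, add_zero, hJ] at this
      rwa [mul_assoc]
  · rintro ⟨ha, hd, hb, hc⟩
    have hb' : ∀ y ∈ J, g 0 1 * y ∈ I := by
      intro y hy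
      have := hOI _ ((hJ y).1 hy) _ hb
      rwa [show δ * y * (g 0 1 / δ) = g 0 1 * y by field_simp] at this
    have hc' : ∀ x ∈ I, g 1 0 * x ∈ J := by
      intro x hx
      rw [hJ, ← mul_assoc]
      exact hc x hx
    have hOJ : ∀ o ∈ O, ∀ y ∈ J, o * y ∈ J := by
      intro o ho y hy
      rw [hJ, mul_left_comm]
      exact O.mul_mem ho ((hJ y).1 hy)
    exact mem_slLattice_of_forall_mem
      (fun x hx y hy => ⟨I.add_mem (hOI _ ha x hx) (hb' y hy), J.add_mem (hc' x hx) (hOJ _ hd y hy)⟩)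
      (fun x hx y hy => ⟨I.sub_mem (hOI _ hd x hx) (hb' y hy),
        J.add_mem (J.neg_mem (hc' x hx)) (hOJ _ ha y hy)⟩)

theorem mem_idealLattice_iff (I : Ideal O) (x : K) :
    x ∈ idealLattice O I ↔ ∃ h : x ∈ O, (⟨x, h⟩ : O) ∈ I := by
  constructor
  · rintro ⟨y, hy, rfl⟩
    exact ⟨y.2, hy⟩
  · rintro ⟨h, hx⟩
    exact ⟨⟨x, h⟩, hx, rfl⟩

/-- The residue map of an ideal of norm two. -/
theorem exists_residue_map {I : Ideal O} (hI : Nat.card (O ⧸ I) = 2) :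
    ∃ π : O →+* ZMod 2, ∀ x, π x = 0 ↔ x ∈ I := by
  have : Finite (O ⧸ I) := Nat.finite_of_card_ne_zero (by omega)
  have : Fintype (O ⧸ I) := Fintype.ofFinite _
  have hcard : Fintype.card (O ⧸ I) = 2 := by rw [← Nat.card_eq_fintype_card, hI]
  let e := ZMod.ringEquivOfPrime (O ⧸ I) Nat.prime_two hcard
  refine ⟨(e.symm : (O ⧸ I) →+* ZMod 2).comp (Ideal.Quotient.mk I), fun x => ?_⟩
  rw [← Ideal.Quotient.eq_zero_iff_mem]
  exact e.symm.map_eq_zero_iff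

variable {Γ₁ Γ₂ : Subgroup SL(2, K)} (π : O →+* ZMod 2)

/-- The index of the intersection in the stabilizer of `O ⊕ δ⁻¹ O`. -/
theorem relIndex_stabilizer_eq_three (hδ : δ ≠ 0)
    (h₁ : ∀ g, g ∈ Γ₁ ↔ g 0 0 ∈ O ∧ g 1 1 ∈ O ∧ g 0 1 / δ ∈ O ∧ δ * g 1 0 ∈ O)
    (h₂ : ∀ g, g ∈ Γ₂ ↔ g 0 0 ∈ O ∧ g 1 1 ∈ O ∧ (∃ h : g 0 1 / δ ∈ O, π ⟨_, h⟩ = 0) ∧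
      ∀ x : O, π x = 0 → δ * g 1 0 * x ∈ O) : Γ₂.relIndex Γ₁ = 3 := by
  obtain ⟨φ, hφ, hφ'⟩ := exists_reduction_mod_two π (Γ := Γ₁) (β := δ) (γ := δ⁻¹)
    (fun g hg => ((h₁ g).1 hg).1) (fun g hg => ((h₁ g).1 hg).2.1)
    (fun g hg => by rw [← div_eq_mul_inv]; exact ((h₁ g).1 hg).2.2.1)
    (fun g hg => by rw [mul_comm]; exact ((h₁ g).1 hg).2.2.2)
    (fun g hg h hh => by
      have := O.mul_mem ((h₁ g).1 hg).2.2.1 ((h₁ h).1 hh).2.2.2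
      rwa [show g 0 1 / δ * (δ * h 1 0) = g 0 1 * h 1 0 by field_simp] at this)
    (by rw [mul_inv_cancel₀ hδ]; exact O.one_mem)
    (by rw [← map_one π]; exact congrArg π (Subtype.ext (mul_inv_cancel₀ hδ)))
    ((h₁ _).2 (by simp [hδ, O.one_mem, O.zero_mem]))
    ((h₁ _).2 (by simp [hδ, O.one_mem, O.zero_mem]))
  refine relIndex_eq_three_of_lower φ hφ fun g => ?_
  rw [(hφ' g).1, h₂]
  obtain ⟨ha, hd, hb, hc⟩ := (h₁ g).1 g.2
  constructor
  · rintro ⟨-, -, ⟨h, hb'⟩, -⟩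
    rw [← hb']
    exact congrArg π (Subtype.ext (div_eq_mul_inv _ _).symm)
  · intro hb'
    refine ⟨ha, hd, ⟨hb, ?_⟩, fun x _ => O.mul_mem hc x.2⟩
    rw [← hb']
    exact congrArg π (Subtype.ext (div_eq_mul_inv _ _))

/-- The index of the intersection in the stabilizer of `I ⊕ δ⁻¹ O` for an ideal `I` of norm two
which is invertible. -/
theorem relIndex_stabilizer_eq_three_of_invertible (hδ : δ ≠ 0)
    (h₁ : ∀ g, g ∈ Γ₁ ↔ g 0 0 ∈ O ∧ g 1 1 ∈ O ∧ g 0 1 / δ ∈ O ∧ δ * g 1 0 ∈ O)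
    (h₂ : ∀ g, g ∈ Γ₂ ↔ g 0 0 ∈ O ∧ g 1 1 ∈ O ∧ (∃ h : g 0 1 / δ ∈ O, π ⟨_, h⟩ = 0) ∧
      ∀ x : O, π x = 0 → δ * g 1 0 * x ∈ O)
    {e : O} {e' : K} (he : π e = 0) (he' : ∀ x : O, π x = 0 → e' * x ∈ O) (hee : (e : K) * e' ∈ O)
    (hee' : π ⟨_, hee⟩ = 1) : Γ₁.relIndex Γ₂ = 3 := by
  -- Modulo `𝔞`, `e ∈ 𝔞` and `e' ∈ (O : 𝔞)` play the role of inverse local generators, so `b` is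
  -- divided by `δ e` and `c` multiplied by it.
  obtain ⟨φ, hφ, hφ'⟩ := exists_reduction_mod_two π (Γ := Γ₂) (β := δ * e) (γ := e' / δ)
    (fun g hg => ((h₂ g).1 hg).1) (fun g hg => ((h₂ g).1 hg).2.1)
    (fun g hg => by
      obtain ⟨h, hh⟩ := ((h₂ g).1 hg).2.2.1
      have := he' _ hh
      rwa [show e' * (g 0 1 / δ) = g 0 1 * (e' / δ) by ring] at this)
    (fun g hg => by
      have := ((h₂ g).1 hg).2.2.2 e he
      rwa [show δ * g 1 0 * e = g 1 0 * (δ * e) by ring] at this)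
    (fun g hg h hh => by
      obtain ⟨hO, h0⟩ := ((h₂ g).1 hg).2.2.1
      have := ((h₂ h).1 hh).2.2.2 _ h0
      rwa [show δ * h 1 0 * (g 0 1 / δ) = g 0 1 * h 1 0 by field_simp] at this)
    (by rwa [show δ * e * (e' / δ) = e * e' by field_simp])
    (by
      rw [← hee']
      exact congrArg π (Subtype.ext (show δ * e * (e' / δ) = e * e' by field_simp)))
    ((h₂ _).2 ⟨by simp, by simp, ⟨by simp [hδ], by
      rw [← he]
      exact congrArg π (Subtype.ext (by simp [hδ]))⟩, by simp⟩)
    ((h₂ _).2 ⟨by simp, by simp, ⟨by simp, by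
      rw [← map_zero π]
      exact congrArg π (Subtype.ext (by simp))⟩, fun x hx => by
        have := he' x hx
        simpa [mul_div_cancel₀ _ hδ] using this⟩)
  refine relIndex_eq_three_of_upper φ hφ fun g => ?_
  rw [(hφ' g).2, h₁]
  obtain ⟨ha, hd, ⟨hb, hb0⟩, hc⟩ := (h₂ g).1 g.2
  constructor
  · rintro ⟨-, -, -, h⟩
    have h0 : π (⟨_, h⟩ * e) = 0 := by rw [map_mul, he, mul_zero]
    exact (congrArg π (Subtype.ext (show g.1 1 0 * (δ * e) = δ * g.1 1 0 * e by ring))).trans h0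
  · intro h
    refine ⟨ha, hd, hb, ?_⟩
    -- Use `δc = e' (δc e) + δc (1 - e e')`, where both `δc e` and `1 - e e'` have residue 0.
    have e1 := he' _ h
    have e2 := hc (1 - ⟨_, hee⟩) (by rw [map_sub, map_one, hee', sub_self])
    have := O.add_mem e1 e2
    convert this using 1
    push_cast
    ring

end LatticeStabilizers

/-! ### Denominators and congruence subgroups. -/

section QuadraticOrders

variable {K : Type*} [Field K] [CharZero K] {D k : ℤ} {sqrtD : K}

theorem sqrt_mem_quadraticOrder (hsqrt : sqrtD ^ 2 = (D : K)) (hk : D ^ 2 - D = 4 * k) :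
    sqrtD ∈ quadraticOrder D sqrtD :=
  (mem_quadraticOrder_iff hsqrt hk _).2 ⟨-D, 2, by push_cast; ring⟩

theorem exists_two_mul_eq (hsqrt : sqrtD ^ 2 = (D : K)) (hk : D ^ 2 - D = 4 * k) {x : K}
    (hx : x ∈ quadraticOrder D sqrtD) : ∃ u v : ℤ, 2 * x = u + v * sqrtD := by
  obtain ⟨u, v, rfl⟩ := (mem_quadraticOrder_iff hsqrt hk _).1 hx
  exact ⟨2 * u + v * D, v, by push_cast; ring⟩

/-- The factor 2 in the condition on `g 1 0` allows one criterion for both groups, because an ideal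
of norm two contains 2. -/
theorem hasBoundedDenominators_of_forall (hsq : ¬ IsSquare D) (hsqrt : sqrtD ^ 2 = (D : K)) (hk : D ^ 2 - D = 4 * k)
    {Γ : Subgroup SL(2, K)} (h : ∀ g ∈ Γ, g 0 0 ∈ quadraticOrder D sqrtD ∧
      g 1 1 ∈ quadraticOrder D sqrtD ∧ g 0 1 / sqrtD ∈ quadraticOrder D sqrtD ∧
      sqrtD * g 1 0 * 2 ∈ quadraticOrder D sqrtD) : HasBoundedDenominators sqrtD Γ := by
  have hδ := sqrt_ne_zero hsq hsqrt
  have hD : D ≠ 0 := by rintro rfl; exact hsq IsSquare.zero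
  refine ⟨4 * D, by simpa using hD, fun g hg i j => ?_⟩
  obtain ⟨ha, hd, hb, hc⟩ := h g hg
  fin_cases i <;> fin_cases j
  · obtain ⟨u, v, huv⟩ := exists_two_mul_eq hsqrt hk ha
    exact ⟨2 * D * u, 2 * D * v, by push_cast; linear_combination 2 * (D : K) * huv⟩
  · obtain ⟨u, v, huv⟩ := exists_two_mul_eq hsqrt hk hb
    refine ⟨2 * D * (D * v), 2 * D * u, ?_⟩
    have e : g 0 1 = sqrtD * (g 0 1 / sqrtD) := by field_simp
    change ((4 * D : ℤ) : K) * g 0 1 = _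
    rw [e]
    push_cast
    linear_combination 2 * (D : K) * sqrtD * huv + 2 * (D : K) * v * hsqrt
  · obtain ⟨u, v, huv⟩ := exists_two_mul_eq hsqrt hk hc
    refine ⟨D * v, u, ?_⟩
    change ((4 * D : ℤ) : K) * g 1 0 = _
    push_cast
    linear_combination sqrtD * huv + (v - 4 * g 1 0 : K) * hsqrt
  · obtain ⟨u, v, huv⟩ := exists_two_mul_eq hsqrt hk hd
    exact ⟨2 * D * u, 2 * D * v, by push_cast; linear_combination 2 * (D : K) * huv⟩

theorem containsCongruenceSubgroup_of_forall (hD : 0 < D) (hsq : ¬ IsSquare D)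
    (hsqrt : sqrtD ^ 2 = (D : K)) (hk : D ^ 2 - D = 4 * k)
    {Γ : Subgroup SL(2, K)} (h : ∀ g : SL(2, K), g 0 0 ∈ quadraticOrder D sqrtD →
      g 1 1 ∈ quadraticOrder D sqrtD → (∃ y ∈ quadraticOrder D sqrtD, g 0 1 / sqrtD = 2 * y) →
      sqrtD * g 1 0 ∈ quadraticOrder D sqrtD → g ∈ Γ) : ContainsCongruenceSubgroup sqrtD Γ := by
  have hδ := sqrt_ne_zero hsq hsqrt
  have hm := sqrt_mem_quadraticOrder hsqrt hk
  have hlin : ∀ u v : ℤ, (u : K) + v * sqrtD ∈ quadraticOrder D sqrtD := fun u v =>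
    add_mem (intCast_mem _ u) (mul_mem (intCast_mem _ v) hm)
  refine ⟨2 * D, by omega, fun g hg => h g ?_ ?_ ?_ ?_⟩
  · obtain ⟨u, v, e⟩ := hg 0 0
    rw [e]
    exact add_mem (by simp) (mul_mem (intCast_mem _ _) (hlin u v))
  · obtain ⟨u, v, e⟩ := hg 1 1
    rw [e]
    exact add_mem (by simp) (mul_mem (intCast_mem _ _) (hlin u v))
  · obtain ⟨u, v, e⟩ := hg 0 1
    refine ⟨sqrtD * (u + v * sqrtD), mul_mem hm (hlin u v), ?_⟩
    rw [e, div_eq_iff hδ]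
    simp
    linear_combination -2 * (u + v * sqrtD) * hsqrt
  · obtain ⟨u, v, e⟩ := hg 1 0
    rw [e]
    refine mul_mem hm (add_mem (by simp) (mul_mem (intCast_mem _ _) (hlin u v)))

end QuadraticOrders

end HilbertModular

namespace HilbertModular

/-! ### Ideals of norm two and the parity of the conductor. -/

section Conductor

variable {K : Type*} [Field K] [CharZero K] {D k : ℤ} {sqrtD : K}

theorem zmod_two_intCast_eq_one_iff (n : ℤ) : (n : ZMod 2) = 1 ↔ ¬ Even n := by
  rw [← ZMod.intCast_eq_zero_iff_even]
  generalize (n : ZMod 2) = x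
  revert x
  decide

/-- An ideal of norm two which contains an element of norm `2 n`, `n` odd, is invertible. -/
theorem exists_inverse_of_norm (hsqrt : sqrtD ^ 2 = (D : K)) (hk : D ^ 2 - D = 4 * k)
    (π : quadraticOrder D sqrtD →+* ZMod 2) {w : quadraticOrder D sqrtD}
    (hw : (w : K) = ((D : K) + sqrtD) / 2) {c n : ℤ} (hc : π w = c) (hn : c ^ 2 - c * D + k = 2 * n)
    (hodd : ¬ Even n) :
    ∃ (e : quadraticOrder D sqrtD) (e' : K), π e = 0 ∧
      (∀ x : quadraticOrder D sqrtD, π x = 0 → e' * x ∈ quadraticOrder D sqrtD) ∧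
      ∃ h : (e : K) * e' ∈ quadraticOrder D sqrtD, π ⟨_, h⟩ = 1 := by
  have hkK : (D : K) ^ 2 - D = 4 * k := by exact_mod_cast congrArg (Int.cast : ℤ → K) hk
  have hnK : (c : K) ^ 2 - c * D + k = 2 * n := by exact_mod_cast congrArg (Int.cast : ℤ → K) hn
  -- Take `e = w - c` and `e'` half its conjugate `D - w - c`; then `e e'` is half the norm. The
  -- kernel of `π` is spanned by `2` and `w - c`, and `e'` maps both into `O`.
  have hnorm : ((w : K) - c) * (((D : K) - w - c) / 2) = n := by
    rw [hw]
    linear_combination -hsqrt / 8 + hkK / 8 + hnK / 2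
  have hcoe : ((w - c : quadraticOrder D sqrtD) : K) = w - c := by push_cast; rfl
  refine ⟨w - c, ((D : K) - w - c) / 2, by rw [map_sub, map_intCast, hc, sub_self], fun x hx => ?_, ?_⟩
  · obtain ⟨u, v, huv⟩ := (mem_quadraticOrder_iff hsqrt hk _).1 x.2
    have hx' : x = u + v * w := Subtype.ext (by push_cast; rw [huv, hw])
    rw [hx', map_add, map_mul, map_intCast, map_intCast, hc, ← Int.cast_mul, ← Int.cast_add,
      ZMod.intCast_eq_zero_iff_even] at hx
    obtain ⟨t, ht⟩ := hx
    have htK : (u : K) + v * c = t + t := by exact_mod_cast congrArg (Int.cast : ℤ → K) ht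
    have : ((D : K) - w - c) / 2 * x = ((t * (D - w - c) + v * n : quadraticOrder D sqrtD) : K) := by
      rw [hx']
      push_cast
      linear_combination ((D : K) - w - c) / 2 * htK + (v : K) * hnorm
    rw [this]
    exact Subtype.property _
  · have hO : ((w - c : quadraticOrder D sqrtD) : K) * (((D : K) - w - c) / 2) =
        ((n : quadraticOrder D sqrtD) : K) := by
      rw [hcoe, hnorm]; push_cast; rfl
    refine ⟨by rw [hO]; exact Subtype.property _, ?_⟩
    have h1 : π (n : quadraticOrder D sqrtD) = 1 := by
      rw [map_intCast]; exact (zmod_two_intCast_eq_one_iff n).2 hodd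
    rw [← h1]
    exact congrArg π (Subtype.ext hO)

/-- If the conductor is odd, then all ideals of norm two are invertible. -/
theorem exists_inverse_of_odd_conductor (hsqrt : sqrtD ^ 2 = (D : K)) (hk : D ^ 2 - D = 4 * k)
    (π : quadraticOrder D sqrtD →+* ZMod 2)
    (hD : (∃ j, D = 2 * j + 1) ∨ ∃ m, D = 4 * m ∧ (m % 4 = 2 ∨ m % 4 = 3)) :
    ∃ (e : quadraticOrder D sqrtD) (e' : K), π e = 0 ∧
      (∀ x : quadraticOrder D sqrtD, π x = 0 → e' * x ∈ quadraticOrder D sqrtD) ∧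
      ∃ h : (e : K) * e' ∈ quadraticOrder D sqrtD, π ⟨_, h⟩ = 1 := by
  let w : quadraticOrder D sqrtD := ⟨((D : K) + sqrtD) / 2,
    (mem_quadraticOrder_iff hsqrt hk _).2 ⟨0, 1, by simp⟩⟩
  have hw : (w : K) = ((D : K) + sqrtD) / 2 := rfl
  have hkK : (D : K) ^ 2 - D = 4 * k := by exact_mod_cast congrArg (Int.cast : ℤ → K) hk
  obtain ⟨r, hr, hr01⟩ : ∃ r : ℤ, π w = r ∧ (r = 0 ∨ r = 1) := by
    have : ∀ x : ZMod 2, x = 0 ∨ x = 1 := by decide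
    rcases this (π w) with h | h
    · exact ⟨0, by simp [h], Or.inl rfl⟩
    · exact ⟨1, by simp [h], Or.inr rfl⟩
  have heq : w * w = D * w - k := Subtype.ext (by
    push_cast
    rw [hw]
    linear_combination hsqrt / 4 - hkK / 4)
  have hev : Even (r ^ 2 - r * D + k) := by
    rw [← ZMod.intCast_eq_zero_iff_even]
    have := congrArg π heq
    rw [map_mul, map_sub, map_mul, map_intCast, map_intCast, hr] at this
    push_cast
    linear_combination this
  obtain ⟨n, hn⟩ := hev
  by_cases hodd : Even n
  · obtain ⟨i, hi⟩ := hodd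
    rcases hD with ⟨j, hj⟩ | ⟨m, hm, hm4⟩
    · refine exists_inverse_of_norm hsqrt hk π hw (c := r - 2) (n := n - 2 * r + 2 + D) ?_ ?_ ?_
      · rw [hr]; push_cast
        have : (2 : ZMod 2) = 0 := by decide
        rw [this, sub_zero]
      · linear_combination hn
      · rw [Int.not_even_iff]
        omega
    -- The norm is `4m² - m` for `r = 0` and `4m² - 5m + 1` for `r = 1`; divisibility by 4 would
    -- force `m ≡ 0` or `m ≡ 1` modulo 4.
    · exfalso
      have hk' : k = 4 * (m * m) - m := by
        have : 4 * k = 4 * (4 * (m * m) - m) := by rw [← hk, hm]; ring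
        omega
      rcases hr01 with rfl | rfl
      · simp at hn; omega
      · simp at hn; omega
  · exact exists_inverse_of_norm hsqrt hk π hw hr (by linear_combination hn) hodd

/-- For even conductor, the index of the intersection in the stabilizer of `I ⊕ δ⁻¹ O` for the
ideal `I` of norm two. -/
theorem relIndex_stabilizer_eq_two_of_even_conductor (hsq : ¬ IsSquare D) (hsqrt : sqrtD ^ 2 = (D : K))
    (hk : D ^ 2 - D = 4 * k) {O : Subalgebra ℤ K} (hO : O = quadraticOrder D sqrtD)
    (π : O →+* ZMod 2) {m : ℤ} (hm : D = 4 * m)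
    (hm4 : m % 4 = 0 ∨ m % 4 = 1) {Γ₁ Γ₂ : Subgroup SL(2, K)}
    (h₁ : ∀ g, g ∈ Γ₁ ↔ g 0 0 ∈ O ∧ g 1 1 ∈ O ∧
      g 0 1 / sqrtD ∈ O ∧ sqrtD * g 1 0 ∈ O)
    (h₂ : ∀ g, g ∈ Γ₂ ↔ g 0 0 ∈ O ∧ g 1 1 ∈ O ∧
      (∃ h : g 0 1 / sqrtD ∈ O, π ⟨_, h⟩ = 0) ∧
      ∀ x : O, π x = 0 → sqrtD * g 1 0 * x ∈ O) :
    Γ₁.relIndex Γ₂ = 2 := by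
  have hδ := sqrt_ne_zero hsq hsqrt
  have hmK : (D : K) = 4 * m := by exact_mod_cast congrArg (Int.cast : ℤ → K) hm
  have hmem : ∀ x, x ∈ O ↔ ∃ u v : ℤ, x = u + v * (sqrtD / 2) := by
    intro x
    rw [hO, mem_quadraticOrder_iff hsqrt hk]
    constructor
    · rintro ⟨u, v, rfl⟩
      exact ⟨u + 2 * m * v, v, by push_cast; rw [hmK]; ring⟩
    · rintro ⟨u, v, rfl⟩
      exact ⟨u - 2 * m * v, v, by push_cast; rw [hmK]; ring⟩
  have huniq : ∀ {u v u' v' : ℚ}, (u : K) + v * (sqrtD / 2) = u' + v' * (sqrtD / 2) →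
      u = u' ∧ v = v' := by
    intro u v u' v' h
    have := rat_coeff_unique (p := u) (q := v / 2) (p' := u') (q' := v' / 2) hsq hsqrt (by
      push_cast; linear_combination h)
    exact ⟨this.1, by linarith [this.2]⟩
  let τ : O := ⟨sqrtD / 2, (hmem _).2 ⟨0, 1, by simp⟩⟩
  have hτ : (τ : K) = sqrtD / 2 := rfl
  have hτsq : (τ : K) ^ 2 = m := by
    rw [hτ]; linear_combination hsqrt / 4 + hmK / 4
  have hπτ : π τ = m := by
    have h1 : τ * τ = (m : O) := Subtype.ext (by push_cast; rw [← hτsq, sq])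
    have h2 := congrArg π h1
    rw [map_mul, map_intCast] at h2
    rw [← h2]
    generalize π τ = x
    revert x
    decide
  obtain ⟨l₀, hl₀⟩ : ∃ l₀ : ℤ, m - m ^ 2 = 2 * (2 * l₀) := by
    rcases hm4 with h | h
    · obtain ⟨i, rfl⟩ : ∃ i, m = 4 * i := ⟨m / 4, by omega⟩
      exact ⟨i - 4 * i ^ 2, by ring⟩
    · obtain ⟨i, rfl⟩ : ∃ i, m = 4 * i + 1 := ⟨m / 4, by omega⟩
      exact ⟨-(4 * i ^ 2 + i), by ring⟩
  have hl₀K : (m : K) - m ^ 2 = 2 * (2 * l₀) := by exact_mod_cast congrArg (Int.cast : ℤ → K) hl₀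
  have htwo : (2 : ZMod 2) = 0 := by decide
  have hcoe2 : ((2 : O) : K) = 2 := rfl
  have hπ2 : π 2 = 0 := by rw [map_ofNat]; exact htwo
  have hπτm : π (τ - m) = 0 := by rw [map_sub, map_intCast, hπτ, sub_self]
  -- One has `c₀² = m c₀ + l₀`, so `ℤ + ℤ c₀` is the order of discriminant `m = D/4`. It contains
  -- `O` with index 2 and preserves the kernel of `π`.
  let c₀ : K := (m + τ) / 2
  have hker : ∀ x : O, π x = 0 → ∃ h : c₀ * x ∈ O, π ⟨_, h⟩ = 0 := by
    intro x hx
    obtain ⟨u, v, huv⟩ := (hmem x).1 x.2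
    have hx' : x = u + v * τ := Subtype.ext (by push_cast; rw [huv])
    have hev : Even (u + v * m) := by
      rw [← ZMod.intCast_eq_zero_iff_even]
      rw [hx', map_add, map_mul, map_intCast, map_intCast, hπτ] at hx
      exact_mod_cast hx
    obtain ⟨p, hp⟩ := hev
    have hpK : (u : K) + v * m = p + p := by exact_mod_cast congrArg (Int.cast : ℤ → K) hp
    have e : c₀ * x = ((p * (m + τ) + v * (2 * l₀) : O) : K) := by
      rw [hx']
      push_cast [hcoe2]
      simp only [c₀]
      linear_combination ((m : K) + τ) / 2 * hpK + (v : K) / 2 * hτsq + (v : K) / 2 * hl₀K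
    refine ⟨by rw [e]; exact Subtype.property _, ?_⟩
    have h0 : π (p * (m + τ) + v * (2 * l₀)) = 0 := by
      rw [map_add, map_mul, map_mul, map_mul, map_add, hπτ, hπ2, map_intCast, map_intCast, ← two_mul, htwo]
      simp
    rw [← h0]
    exact congrArg π (Subtype.ext e)
  have hc₀ : ∀ v l : ℤ, (v : K) * c₀ + l ∈ O ↔ Even v := by
    intro v l
    constructor
    · intro h
      obtain ⟨u', v', e⟩ := (hmem _).1 h
      have := (huniq (u := v * m / 2 + l) (v := v / 2) (u' := u') (v' := v') (by
        push_cast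
        rw [← e]
        simp only [c₀, hτ]
        ring)).2
      refine ⟨v', ?_⟩
      have h2 : (v : ℚ) = v' + v' := by linarith
      exact_mod_cast h2
    · rintro ⟨i, hi⟩
      have hiK : (v : K) = i + i := by exact_mod_cast congrArg (Int.cast : ℤ → K) hi
      have e : (v : K) * c₀ + l = ((i * (m + τ) + l : O) : K) := by
        push_cast
        simp only [c₀]
        rw [hiK]
        ring
      rw [e]
      exact Subtype.property _
  -- Testing `δc` on `2` and `τ - m` places it in `ℤ + ℤ c₀`; the parity of `v` is its class modulo
  -- `O`.
  have hform : ∀ g ∈ Γ₂, ∃ v l : ℤ, sqrtD * g 1 0 = v * c₀ + l := by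
    intro g hg
    obtain ⟨-, -, -, hc⟩ := (h₂ g).1 hg
    obtain ⟨u, v, e⟩ := (hmem _).1 (hc 2 hπ2)
    obtain ⟨u', v', e'⟩ := (hmem _).1 (hc _ hπτm)
    have h2 := (huniq (u := (v - u) * m / 2) (v := (u - v * m) / 2) (u' := u') (v' := v') (by
      push_cast [hcoe2] at e e' ⊢
      rw [← e', ← hτ]
      rw [← hτ] at e
      linear_combination (-((τ : K) - m) / 2) * e - (v : K) / 2 * hτsq)).2
    have h3 : (u : ℚ) = v * m + 2 * v' := by linarith
    have h3K : (u : K) = v * m + 2 * v' := by exact_mod_cast congrArg (Rat.cast : ℚ → K) h3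
    refine ⟨v, v', ?_⟩
    push_cast [hcoe2] at e
    simp only [c₀, hτ]
    linear_combination e / 2 + h3K / 2
  -- The product `(b/δ)(δc)` lies in the kernel of `π`, so the determinant gives `π a * π d = 1`.
  have hdiag : ∀ g (hg : g ∈ Γ₂), π ⟨g 1 1, ((h₂ g).1 hg).2.1⟩ = 1 := by
    intro g hg
    obtain ⟨v, l, hvl⟩ := hform g hg
    obtain ⟨ha, hd, ⟨hb, hb0⟩, -⟩ := (h₂ g).1 hg
    obtain ⟨hcb, hcb0⟩ := hker _ hb0
    have hdet : (⟨_, ha⟩ * ⟨_, hd⟩ - (v * ⟨_, hcb⟩ + l * ⟨_, hb⟩) : O) = 1 := by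
      apply Subtype.ext
      push_cast
      have := g.det_coe
      rw [Matrix.det_fin_two] at this
      refine Eq.trans ?_ this
      have e : g 0 1 * g 1 0 = g 0 1 / sqrtD * (sqrtD * g 1 0) := by field_simp
      rw [e, hvl]
      ring
    have := congrArg π hdet
    rw [map_sub, map_mul, map_add, map_mul, map_mul, hcb0, hb0, map_one, mul_zero, mul_zero, add_zero,
      sub_zero] at this
    revert this
    generalize π ⟨_, ha⟩ = x
    generalize π ⟨_, hd⟩ = y
    revert x y
    decide
  have hΓ : ∀ g ∈ Γ₂, g ∈ Γ₁ ↔ sqrtD * g 1 0 ∈ O := by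
    intro g hg
    obtain ⟨ha, hd, ⟨hb, -⟩, -⟩ := (h₂ g).1 hg
    rw [h₁]
    exact ⟨fun h => h.2.2.2, fun h => ⟨ha, hd, hb, h⟩⟩
  let a : SL(2, K) := ⟨!![1, 0; c₀ / sqrtD, 1], by simp⟩
  have ha : a ∈ Γ₂ := (h₂ a).2 ⟨by simp [a], by simp [a], ⟨by simp [a], by
    rw [← map_zero π]
    exact congrArg π (Subtype.ext (by simp [a]))⟩, fun x hx => by
      obtain ⟨h, -⟩ := hker x hx
      simpa [a, mul_div_cancel₀ _ hδ] using h⟩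
  refine Subgroup.relIndex_eq_two_iff.2 ⟨a, ha, fun b hb => ?_⟩
  rw [hΓ b hb, hΓ _ (mul_mem hb ha)]
  obtain ⟨v, l, hvl⟩ := hform b hb
  obtain ⟨-, hd, -, -⟩ := (h₂ b).1 hb
  obtain ⟨hd', -⟩ := hker (⟨_, hd⟩ - 1) (by rw [map_sub, hdiag b hb, map_one, sub_self])
  -- Right multiplication by `a` adds `d c₀`, which is `c₀` modulo `O` because `d - 1` lies in the
  -- kernel of `π`; the parity of `v` flips.
  have e : sqrtD * (b * a) 1 0 = (((v + 1 : ℤ) : K) * c₀ + l) + c₀ * ((⟨_, hd⟩ - 1 : O) : K) := by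
    rw [Matrix.SpecialLinearGroup.coe_mul, Matrix.mul_apply, Fin.sum_univ_two]
    simp only [a, Matrix.of_apply, Matrix.cons_val_zero, Matrix.cons_val_one]
    push_cast
    have e2 : sqrtD * (b 1 0 * 1 + b 1 1 * (c₀ / sqrtD)) = sqrtD * b 1 0 + b 1 1 * c₀ := by
      field_simp
    rw [e2, hvl]
    ring
  rw [e, add_mem_cancel_right hd', hc₀, hvl, hc₀, Int.even_add_one]
  by_cases hv : Even v <;> simp [hv]

end Conductor

end HilbertModular

namespace HilbertModular

open MeasureTheory

/-! ### Euler characteristics from indices. -/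

section EulerCharRatio

variable {K : Type*} [Field K] {ι₁ ι₂ : K →+* ℝ}

theorem map_inf_of_ker_le {G G' : Type*} [Group G] [Group G'] (φ : G →* G') {H₁ H₂ : Subgroup G}
    (h₂ : φ.ker ≤ H₂) : (H₁ ⊓ H₂).map φ = H₁.map φ ⊓ H₂.map φ := by
  refine le_antisymm (Subgroup.map_inf_le _ _ _) ?_
  rintro _ ⟨⟨x, hx, rfl⟩, hy⟩
  refine ⟨x, ⟨hx, ?_⟩, rfl⟩
  have : x ∈ (H₂.map φ).comap φ := hy
  rwa [Subgroup.comap_map_eq_self h₂] at this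

theorem relIndex_map_of_ker_le {G G' : Type*} [Group G] [Group G'] (φ : G →* G')
    {H₁ H₂ : Subgroup G} (h₁ : φ.ker ≤ H₁) (h₂ : φ.ker ≤ H₂) :
    (H₁.map φ).relIndex (H₂.map φ) = H₁.relIndex H₂ := by
  rw [Subgroup.relIndex_map_map, sup_of_le_left h₁, sup_of_le_left h₂]

/-- The orbifold Euler characteristics of commensurable groups are proportional to the inverse
ratio of their indices over the intersection. -/
theorem orbifoldEulerChar_div [CharZero K] [Countable K] {D : ℤ} {sqrtD : K}
    (hsqrt : sqrtD ^ 2 = (D : K)) (hD : ¬ IsSquare D) (hs : ι₁ sqrtD ≠ 0)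
    (hι : ι₂ sqrtD = -ι₁ sqrtD) {Γ₁ Γ₂ : Subgroup SL(2, K)} (hΓ₁ : HasBoundedDenominators sqrtD Γ₁)
    (hΓ₂ : HasBoundedDenominators sqrtD Γ₂) (hΓ : ContainsCongruenceSubgroup sqrtD Γ₁)
    (hneg₁ : -1 ∈ Γ₁) (hneg₂ : -1 ∈ Γ₂) (h₁ : Γ₂.relIndex Γ₁ ≠ 0) (h₂ : Γ₁.relIndex Γ₂ ≠ 0) :
    orbifoldEulerChar (Γ₂.map (actionHom ι₁ ι₂)) / orbifoldEulerChar (Γ₁.map (actionHom ι₁ ι₂)) =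
      Γ₂.relIndex Γ₁ / Γ₁.relIndex Γ₂ := by
  have k₁ := ker_actionHom_le ι₁ ι₂ hneg₁
  have k₂ := ker_actionHom_le ι₁ ι₂ hneg₂
  have := countable_map_actionHom ι₁ ι₂ Γ₁
  have := countable_map_actionHom ι₁ ι₂ Γ₂
  obtain ⟨s₁, hs₁⟩ := exists_isFundamentalDomain_map hs hι hΓ₁
  obtain ⟨s₂, hs₂⟩ := exists_isFundamentalDomain_map hs hι hΓ₂
  obtain ⟨t, ht⟩ := exists_isFundamentalDomain_map (Γ := Γ₁ ⊓ Γ₂) hs hι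
    (hΓ₁.imp fun m hm => ⟨hm.1, fun g hg => hm.2 g hg.1⟩)
  rw [map_inf_of_ker_le _ k₂] at ht
  obtain ⟨S, hS, hcov⟩ := exists_covering_measure_lt_top (ι₁ := ι₁) (ι₂ := ι₂) hsqrt hD hs hι hΓ
  have hfin := (measure_fundamentalDomain_le_of_forall_exists_smul_mem hs₁ hcov).trans_lt hS
  rw [← relIndex_map_of_ker_le (actionHom ι₁ ι₂) k₁ k₂, ← relIndex_map_of_ker_le _ k₂ k₁] at *
  exact covolume_ratio h₁ h₂ hs₁ hs₂ ht (hs₁.measure_ne_zero gaussBonnetMeasure_ne_zero) hfin.ne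

end EulerCharRatio

/-! ### The two Hilbert modular groups. -/

section Surfaces

variable {K : Type*} [Field K] [NumberField K] {ι₁ ι₂ : K →+* ℝ} {D k : ℤ} {sqrtD : K}

theorem mem_slLattice_quadraticOrder_iff (hK : Module.finrank ℚ K = 2) (hsq : ¬ IsSquare D)
    (hsqrt : sqrtD ^ 2 = (D : K)) (hk : D ^ 2 - D = 4 * k) (g : SL(2, K)) :
    g ∈ slLattice (Subalgebra.toSubmodule (quadraticOrder D sqrtD))
        (traceDual (quadraticOrder D sqrtD)) ↔
      g 0 0 ∈ quadraticOrder D sqrtD ∧ g 1 1 ∈ quadraticOrder D sqrtD ∧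
        g 0 1 / sqrtD ∈ quadraticOrder D sqrtD ∧ sqrtD * g 1 0 ∈ quadraticOrder D sqrtD := by
  rw [mem_slLattice_iff (sqrt_ne_zero hsq hsqrt) (mem_traceDual_iff hK hsq hsqrt hk)
    (fun o ho x hx => (quadraticOrder D sqrtD).mul_mem ho hx)]
  simp only [Subalgebra.mem_toSubmodule]
  refine and_congr_right fun _ => and_congr_right fun _ => and_congr_right fun _ => ?_
  exact ⟨fun h => by simpa using h 1 (one_mem _), fun h x hx => mul_mem h hx⟩

theorem mem_slLattice_idealLattice_iff (hK : Module.finrank ℚ K = 2) (hsq : ¬ IsSquare D)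
    (hsqrt : sqrtD ^ 2 = (D : K)) (hk : D ^ 2 - D = 4 * k) {𝔞 : Ideal (quadraticOrder D sqrtD)}
    {π : quadraticOrder D sqrtD →+* ZMod 2} (hπ : ∀ x, π x = 0 ↔ x ∈ 𝔞) (g : SL(2, K)) :
    g ∈ slLattice (idealLattice (quadraticOrder D sqrtD) 𝔞)
        (traceDual (quadraticOrder D sqrtD)) ↔
      g 0 0 ∈ quadraticOrder D sqrtD ∧ g 1 1 ∈ quadraticOrder D sqrtD ∧
        (∃ h : g 0 1 / sqrtD ∈ quadraticOrder D sqrtD, π ⟨_, h⟩ = 0) ∧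
        ∀ x : quadraticOrder D sqrtD, π x = 0 → sqrtD * g 1 0 * x ∈ quadraticOrder D sqrtD := by
  rw [mem_slLattice_iff (sqrt_ne_zero hsq hsqrt) (mem_traceDual_iff hK hsq hsqrt hk)
    (fun o ho x hx => by
      obtain ⟨h, hx⟩ := (mem_idealLattice_iff 𝔞 x).1 hx
      exact (mem_idealLattice_iff 𝔞 _).2 ⟨mul_mem ho h, 𝔞.mul_mem_left ⟨o, ho⟩ hx⟩)]
  simp only [mem_idealLattice_iff, hπ]
  refine and_congr_right fun _ => and_congr_right fun _ => and_congr_right fun _ => ?_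
  exact ⟨fun h x hx => h x ⟨x.2, hx⟩, fun h x ⟨hx, hx'⟩ => h ⟨x, hx⟩ hx'⟩

theorem orbifoldEulerChar_groupX12_div (hK : Module.finrank ℚ K = 2) (hι : ι₁ ≠ ι₂)
    (hsq : ¬ IsSquare D) (hsqrt : sqrtD ^ 2 = (D : K)) (hk : D ^ 2 - D = 4 * k)
    (𝔞 : Ideal (quadraticOrder D sqrtD)) (h𝔞 : Nat.card (quadraticOrder D sqrtD ⧸ 𝔞) = 2) :
    ((∃ m, D = 4 * m ∧ (m % 4 = 0 ∨ m % 4 = 1)) →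
      orbifoldEulerChar (groupX12 ι₁ ι₂ D sqrtD 𝔞) / orbifoldEulerChar (groupX ι₁ ι₂ D sqrtD) =
        3 / 2) ∧
    (((∃ j, D = 2 * j + 1) ∨ ∃ m, D = 4 * m ∧ (m % 4 = 2 ∨ m % 4 = 3)) →
      orbifoldEulerChar (groupX12 ι₁ ι₂ D sqrtD 𝔞) / orbifoldEulerChar (groupX ι₁ ι₂ D sqrtD) =
        1) := by
  have hδ := sqrt_ne_zero hsq hsqrt
  have hneg := embedding_sqrt_eq_neg hK hsq hsqrt hι
  have hs : ι₁ sqrtD ≠ 0 := (map_ne_zero ι₁).2 hδ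
  have hD : 0 < D := by
    have h : (ι₁ sqrtD) ^ 2 = (D : ℝ) := by rw [← map_pow, hsqrt, map_intCast]
    have : (0 : ℝ) < D := h ▸ by positivity
    exact_mod_cast this
  have : Countable K := (quadraticBasis hK hsq hsqrt).equivFun.injective.countable
  obtain ⟨π, hπ⟩ := exists_residue_map h𝔞
  have h₁ := mem_slLattice_quadraticOrder_iff hK hsq hsqrt hk
  have h₂ := mem_slLattice_idealLattice_iff hK hsq hsqrt hk hπ
  unfold groupX groupX12
  -- From here on only the descriptions `h₁` and `h₂` by matrix entries are used.
  generalize slLattice (Subalgebra.toSubmodule (quadraticOrder D sqrtD)) _ = Γ₁ at h₁ ⊢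
  generalize slLattice (idealLattice (quadraticOrder D sqrtD) 𝔞) _ = Γ₂ at h₂ ⊢
  have hb₁ : HasBoundedDenominators sqrtD Γ₁ :=
    hasBoundedDenominators_of_forall hsq hsqrt hk fun g hg => by
      obtain ⟨ha, hd, hb, hc⟩ := (h₁ g).1 hg
      exact ⟨ha, hd, hb, mul_mem hc (ofNat_mem _ 2)⟩
  have hb₂ : HasBoundedDenominators sqrtD Γ₂ :=
    hasBoundedDenominators_of_forall hsq hsqrt hk fun g hg => by
      obtain ⟨ha, hd, ⟨hb, -⟩, hc⟩ := (h₂ g).1 hg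
      exact ⟨ha, hd, hb, hc 2 (by rw [map_ofNat]; decide)⟩
  have hc₁ : ContainsCongruenceSubgroup sqrtD Γ₁ :=
    containsCongruenceSubgroup_of_forall hD hsq hsqrt hk fun g ha hd ⟨y, hy, hb⟩ hc =>
      (h₁ g).2 ⟨ha, hd, hb ▸ mul_mem (ofNat_mem _ 2) hy, hc⟩
  have hn₁ : -1 ∈ Γ₁ := (h₁ _).2 (by simp)
  have hn₂ : -1 ∈ Γ₂ := (h₂ _).2 (by
    refine ⟨by simp, by simp, ⟨by simp, ?_⟩, by simp⟩
    exact (congrArg π (Subtype.ext (by simp) : _ = (0 : quadraticOrder D sqrtD))).trans (map_zero π))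
  have h3 := relIndex_stabilizer_eq_three π hδ h₁ h₂
  have key := orbifoldEulerChar_div (ι₁ := ι₁) (ι₂ := ι₂) hsqrt hsq hs hneg hb₁ hb₂ hc₁ hn₁ hn₂ (by rw [h3]; decide)
  constructor
  · rintro ⟨m, hm, hm4⟩
    have h2 := relIndex_stabilizer_eq_two_of_even_conductor hsq hsqrt hk rfl π hm hm4 h₁ h₂
    rw [key (by rw [h2]; decide), h2, h3]
    norm_num
  · intro hodd
    obtain ⟨e, e', he, he', hee, hee'⟩ := exists_inverse_of_odd_conductor hsqrt hk π hodd
    have h3' := relIndex_stabilizer_eq_three_of_invertible π hδ h₁ h₂ he he' hee hee'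
    rw [key (by rw [h3']; decide), h3', h3]
    norm_num

end Surfaces

end HilbertModular

theorem mainTheorem8 {K : Type*} [Field K] [NumberField K] (hK : Module.finrank ℚ K = 2)
    (ι₁ ι₂ : K →+* ℝ) (hι : ι₁ ≠ ι₂)
    (D D₀ : ℤ) (f : ℕ) (hD₀ : HilbertModular.IsFundamentalDiscriminant D₀)
    (hD : D = (f : ℤ) ^ 2 * D₀) (hsq : ¬ IsSquare D)
    (sqrtD : K) (hsqrt : sqrtD ^ 2 = (D : K))
    (𝔞 : Ideal (HilbertModular.quadraticOrder D sqrtD))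
    (h𝔞 : Nat.card (HilbertModular.quadraticOrder D sqrtD ⧸ 𝔞) = 2) :
    HilbertModular.orbifoldEulerChar (HilbertModular.groupX12 ι₁ ι₂ D sqrtD 𝔞) /
        HilbertModular.orbifoldEulerChar (HilbertModular.groupX ι₁ ι₂ D sqrtD) =
      if 2 ∣ f then (3 / 2 : ℝ) else 1 := by
  obtain ⟨k, hk⟩ := hD₀.four_dvd f
  rw [← hD] at hk
  have h := HilbertModular.orbifoldEulerChar_groupX12_div hK hι hsq hsqrt hk 𝔞 h𝔞
  split_ifs with hf
  · exact h.1 (hD ▸ hD₀.even_conductor hf)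
  · exact h.2 (hD ▸ hD₀.odd_conductor hf)
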